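/- **Notation.** Let $\alpha=(1+i\sqrt3)/2$, let $\mathcal E=\{a+b\alpha: a,b\in\mathbf Z\}$ be the ring of Eisenstein integers, and let $\mathcal T$ be the unit equilateral triangulation of $\mathbf C$ with vertex set $\mathcal E$. For $0\neq\beta\in\mathcal E$ let $G_\beta$ be the group generated by the order $3$ rotations about the points of $\beta\mathcal E$, and let $\mathcal T(\beta)=\mathcal T/G_\beta$, a triangulation of the sphere with degree sequence $6,\dots,6,2,2,2$. **The coloring $\mathcal C(a+b\alpha)$.** Let $0<a<b$ be coprime integers and $\beta=a+b\alpha$. For integers $0<x\le y$ let $X(x,y)$ be the isosceles trapezoid (a triangle if $x=y$) with vertices $x+y\alpha$, $(x-y)+y\alpha$, $(2x-y)+(y-x)\alpha$, $x+(y-x)\alpha$; its diagonal sides have length $x$, its top has length $y$ and its bottom has length $y-x$. For $x>y>0$ let $X(x,y)$ be the image of $X(y,x)$ under the reflection $u+v\alpha\mapsto v+u\alpha$. The necklace $N(x,y)$ is the union of the six trapezoids $\alpha^kX(x,y)$; its aspect ratio is $\min(x,y)/\max(x,y)$. Let $(x_0,y_0)=(a,b)$. While $x_k\ne y_k$, let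 $(x_{k+1},y_{k+1})$ be $(x_k,y_k-x_k)$ if $x_k<y_k$ and $(x_k-y_k,y_k)$ if $x_k>y_k$. This ends at $(1,1)$, and the aspect ratios change by the slow Gauss map. The necklaces $N(x_k,y_k)$ are nested with disjoint interiors. Color their faces black for even $k$ and white for odd $k$, and color the remaining six faces around $0$ alternately black and white, those with vertices $0,\alpha^k,\alpha^{k+1}$ being black for even $k$. The union of all these faces is the flower centered at $0$. It lies in the regular hexagon with vertices $\alpha^k\beta$. Place translates of this colored flower at all points of $(1+\alpha)\beta\mathcal E$, the centers of the tiling of the plane by translates of that hexagon, and color all other faces of $\mathcal T$ white (the color opposite to that of the outermost necklaces). The result is $G_\beta$-invariant, and $\mathcal C(a+b\alpha)$ is the induced black-white face coloring of $\mathcal T(a+b\alpha)$. Its *fold count* is the number of edges of $\mathcal T(a+b\alpha)$ between a black and a white face. **Theorem.** Let $(a_n/b_n)$ be a sequence of rationals in $(0,1)$, in lowest terms. Let $f_n$ be the fold count of $\mathcal C(a_n+b_n\alpha)$ and let $F_n$ be the number of faces of $\mathcal T(a_n+b_n\alpha)$. 1. If $a_n/b_n$ converges to an irrational number, then $\lim_{n\to\infty}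 f_n/F_n=0$. 2. If $(a_n/b_n)$ is the sequence of continued fraction approximants (convergents) of a quadratic irrational $\zeta\in(0,1)$, possibly with finitely many initial approximants omitted (the first ones may be $0$ or $1$), then $\lim_{n\to\infty} f_n^2/F_n$ exists, is finite, and lies in $\mathbf Q(\zeta)$. -/

import Mathlib

open scoped Pointwise

/-! ### The Eisenstein integers and the equilateral triangulation of the plane -/

/-- The ring of Eisenstein integers `a + b α` with `α = (1 + i √3) / 2`, so that `α ^ 2 = -1 + α`.
The element `a + b α` is `⟨a, b⟩`. -/
abbrev Eisenstein : Type := QuadraticAlgebra ℤ (-1) 1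

namespace Eisenstein

/-- The sixth root of unity `α = (1 + i √3) / 2`. -/
def alpha : Eisenstein := ⟨0, 1⟩

/-- The position of an Eisenstein integer in the plane. -/
noncomputable def toComplex (z : Eisenstein) : ℂ :=
  (z.re : ℂ) + (z.im : ℂ) * ((1 + Complex.I * (Real.sqrt 3 : ℂ)) / 2)

/-- The edges of the unit equilateral triangulation `T` of the plane (as sets of endpoints): the
neighbours of `z` are `z + α ^ k`. -/
def edges : Set (Finset Eisenstein) :=
  {e | ∃ (z : Eisenstein) (k : ℕ), e = {z, z + alpha ^ k}}

/-- The faces of the unit equilateral triangulation `T` of the plane (as sets of vertices). -/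
def faces : Set (Finset Eisenstein) :=
  {t | ∃ (z : Eisenstein) (k : ℕ), t = {z, z + alpha ^ k, z + alpha ^ (k + 1)}}

/-- The rotation of order `3` about the Eisenstein integer `p`, that is `z ↦ p + α² (z - p)`. -/
def rotation (p : Eisenstein) : Equiv.Perm Eisenstein where
  toFun z := p + alpha ^ 2 * (z - p)
  invFun z := p + alpha ^ 4 * (z - p)
  left_inv z := by
    have h : alpha ^ 4 * alpha ^ 2 = 1 := by decide
    linear_combination (z - p) * h
  right_inv z := by
    have h : alpha ^ 4 * alpha ^ 2 = 1 := by decide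
    linear_combination (z - p) * h

/-- The group `G_β` generated by the rotations of order `3` about the vertices `β w` of the scaled
triangulation `β T`. -/
def rotationGroup (β : Eisenstein) : Subgroup (Equiv.Perm Eisenstein) :=
  Subgroup.closure (Set.range fun w : Eisenstein => rotation (β * w))

/-- The quotient map by `G_β` on finite sets of Eisenstein integers. The faces and the edges of the
sphere triangulation `T(β) = T / G_β` are the images of the faces and of the edges of `T`. -/
def toQuotient (β : Eisenstein) (s : Finset Eisenstein) :
    MulAction.orbitRel.Quotient (rotationGroup β) (Finset Eisenstein) :=
  Quotient.mk _ s

/-- The number of faces of `T(β)`. -/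
noncomputable def faceCount (β : Eisenstein) : ℕ :=
  (toQuotient β '' faces).ncard

/-! ### Trapezoid necklaces -/

/-- The vertices of the normalized Eisenstein trapezoid centred at `0` with diagonal sides of length
`a` and top of length `b`, for `a ≤ b`. The top joins vertices `0` and `1`, the bottom joins
vertices `2` and `3`, and the diagonal sides join `1` and `2`, respectively `3` and `0`. -/
def standardTrapezoid (a b : ℤ) : Fin 4 → Eisenstein :=
  ![⟨a, b⟩, ⟨a - b, b⟩, ⟨2 * a - b, b - a⟩, ⟨a, b - a⟩]

/-- The reflection of the plane in the line through `0` and `1 + α`. -/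
def mirror (z : Eisenstein) : Eisenstein := ⟨z.im, z.re⟩

/-- The trapezoid with outer vertex `x + y α`. Its top has length `max x y`, and its diagonal sides
have length `min x y`. It is in normalized position if `x ≤ y`, and the mirror image of a trapezoid
in normalized position otherwise. -/
def trapezoid (x y : ℤ) : Fin 4 → Eisenstein :=
  if x ≤ y then standardTrapezoid x y else mirror ∘ standardTrapezoid y x

/-- The trapezoid as a (solid) region of the plane. -/
noncomputable def trapezoidRegion (x y : ℤ) : Set ℂ :=
  convexHull ℝ (Set.range fun i => toComplex (trapezoid x y i))

/-- The faces of the trapezoid necklace centred at `0`: the faces contained in one of the six images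
of the trapezoid under the rotations by powers of `α`. -/
def necklace (x y : ℤ) : Set (Finset Eisenstein) :=
  {t | t ∈ faces ∧ ∃ k : ℕ, ∀ v ∈ t, toComplex (alpha ^ k * v) ∈ trapezoidRegion x y}

/-- `IsLayer a b k x y` says that the empty flower whose outer necklace has the outer vertex
`a + b α` has a `k`-th necklace `γ ^ k (X)` (counted from the outside, starting with `0`), and that
the outer vertex of this necklace is `x + y α`. The aspect ratio changes by the slow Gauss map,
`x / (x + y) ↦ x / y` or `y / x`, and the last necklace is the one of aspect ratio `1`. -/
inductive IsLayer (a b : ℤ) : ℕ → ℤ → ℤ → Prop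
  | outer : IsLayer a b 0 a b
  | left {k : ℕ} {x y : ℤ} : IsLayer a b k x y → x < y → IsLayer a b (k + 1) x (y - x)
  | right {k : ℕ} {x y : ℤ} : IsLayer a b k x y → y < x → IsLayer a b (k + 1) (x - y) y

/-- One step of the construction obeys the defining property of `Y = γ(X)` (case `x < y`): one of
the top and the diagonal side `3 0` of `Y` is the bottom of the trapezoid of `X`, and the other one
is a diagonal side of the adjacent trapezoid of `X`. The case `y < x` is the mirror image. -/
theorem layer_step {x y : ℤ} (hxy : x < y) :
    let X := trapezoid x y
    let Y := trapezoid x (y - x)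
    (x ≤ y - x → Y 0 = X 3 ∧ Y 1 = X 2 ∧ alpha * Y 0 = X 1 ∧ alpha * Y 3 = X 2) ∧
    (y - x < x → Y 0 = X 3 ∧ Y 3 = X 2 ∧ alpha * Y 0 = X 1 ∧ alpha * Y 1 = X 2) := by
  intro X Y
  constructor
  · intro h
    simp only [X, Y, trapezoid, if_pos hxy.le, if_pos h]
    refine ⟨?_, ?_, ?_, ?_⟩ <;>
      ext <;> simp [standardTrapezoid, alpha] <;> ring
  · intro h
    simp only [X, Y, trapezoid, if_pos hxy.le, if_neg (not_le.mpr h)]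
    refine ⟨?_, ?_, ?_, ?_⟩ <;>
      ext <;> simp [standardTrapezoid, mirror, alpha] <;> ring

/-- The trapezoids for `(x, y)` and `(y, x)` are mirror images of each other. -/
theorem trapezoid_mirror {x y : ℤ} (hxy : x < y) : trapezoid y x = mirror ∘ trapezoid x y := by
  simp [trapezoid, hxy.le, not_le.mpr hxy]

/-! ### The continued fraction colorings -/

/-- The black faces of the flower centred at `0` with outer vertex `β`. The necklaces of the empty
flower are coloured alternately, the outermost one being black, and the remaining six faces around
`0` are coloured alternately black and white. -/
def flowerBlack (β : Eisenstein) : Set (Finset Eisenstein) :=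
  {t | (∃ (k : ℕ) (x y : ℤ), Even k ∧ IsLayer β.re β.im k x y ∧ t ∈ necklace x y) ∨
    ∃ k : ℕ, Even k ∧ t = {0, alpha ^ k, alpha ^ (k + 1)}}

/-- The black faces of the planar coloring whose quotient by `G_β` is `C(β)`; all other faces are
white. The plane is tiled by the translates of the capped flower, a regular hexagon with centre `0`
and vertices `α ^ k β`; the centres of these hexagons are the points `(1 + α) β w`. The caps, that
is the parts of the hexagons outside the flowers, have the colour opposite to that of the outermost
necklaces, so they are white. -/
def blackFaces (β : Eisenstein) : Set (Finset Eisenstein) :=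
  {t | ∃ w : Eisenstein, ∃ s ∈ flowerBlack β, t = ((1 + alpha) * β * w) +ᵥ s}

/-- The edges of `T` that form black-white interfaces: one of the two faces at the edge is black and
the other one is white. -/
def foldEdges (β : Eisenstein) : Set (Finset Eisenstein) :=
  {e | e ∈ edges ∧ ∃ s ∈ faces, ∃ t ∈ faces,
    e ⊆ s ∧ e ⊆ t ∧ s ∈ blackFaces β ∧ t ∉ blackFaces β}

/-- The fold count of the continued fraction coloring `C(β)` of `T(β)`: the number of edges of
`T(β)` that form black-white interfaces. -/
noncomputable def foldCount (β : Eisenstein) : ℕ :=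
  (toQuotient β '' foldEdges β).ncard

end Eisenstein

/-!
Everything is reduced to the subtractive Euclidean algorithm `(x, y) ↦ (x, y - x)` or `(x - y, y)`,
which produces the outer vertices `x + y α` of the layers of a flower.

**Geometry.** The region inside the necklace with outer vertex `x + y α` (the *solid flower*) is the
complement of the six images, under rotations by `α ^ k`, of the wedge `v ≥ y`, `u + v ≥ x` (in
coordinates `u + v α`). Thus membership of a face is a Boolean combination of linear inequalities
(`UpIn`), a layer is the difference of two consecutive solid flowers (`up_mem_necklace`), and the
boundary of a solid flower is an explicit set of edges (`onBoundary_iff`), of which `2 (x + y)` are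
horizontal. Every edge is equivalent under `G_β` to a horizontal one, and horizontal edges are
equivalent only by translations in `(1 + α) β E`. The flower lies in the Voronoi cell of this lattice
(`abs_lt_of_in`), so that different flowers do not interfere, and the fold count is `2 ∑ (x + y)`,
summed over all layers, up to a bounded contribution of the six central faces (`foldCount_bounds`).
The number of faces is `2 (a² + a b + b²)` (`faceCount_eq`): modulo translations there are
`3 (a² + a b + b²)` faces of each of the two orientations, and `G_β` identifies them three by three.

**Irrational limits.** The first `m` layers contribute `O(m b)` to the fold count and the remaining
ones at most the square of the size of the pair reached after `m` steps (`sum_weight_le`). After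
division by `b²` and passage to the limit, only the squared size of the pair reached after `m` steps
from `(ζ, 1)` is left, which tends to `0` as `m → ∞` (`Incommensurable.tendsto_sum`).

**Quadratic irrationals.** The algorithm acts on integral binary quadratic forms of a fixed
discriminant. After finitely many steps the form vanishing at the current pair has outer coefficients
of opposite signs, and there are only finitely many such forms. Hence the algorithm started at
`(ζ, 1)` is eventually periodic up to scaling, and the ratios of the components are bounded
(`exists_period`); the sum `S` of `x + y` over all its pairs is a finite sum plus a geometric series
in `ℚ(ζ)` (`tsum_mem`). A convergent `a / b` satisfies `|ζ - a / b| < 1 / b²`, which forces the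
algorithm to take the same steps for `(a, b)` as for `(ζ, 1)` until it reaches `(1, 1)`
(`branch_iff`). This bounds the normalized contributions of the layers (`weight_le`), so the
normalized fold count tends to `2 S` by dominated convergence, and `f² / F` tends to
`(2 S)² / (2 (ζ² + ζ + 1))`.
-/

namespace Eisenstein

open scoped QuadraticAlgebra

/-! ### Faces and edges in coordinates -/

theorem alpha_pow_two : alpha ^ 2 = ⟨-1, 1⟩ := by decide

theorem alpha_pow_three : alpha ^ 3 = ⟨-1, 0⟩ := by decide

theorem alpha_pow_four : alpha ^ 4 = ⟨0, -1⟩ := by decide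

theorem alpha_pow_five : alpha ^ 5 = ⟨1, -1⟩ := by decide

theorem alpha_pow_six : alpha ^ 6 = 1 := by decide

theorem alpha_pow_mod (k : ℕ) : alpha ^ k = alpha ^ (k % 6) := by
  conv_lhs => rw [← Nat.div_add_mod k 6, pow_add, pow_mul, alpha_pow_six, one_pow, one_mul]

theorem alpha_pow_cases (k : ℕ) :
    k % 6 = 0 ∧ alpha ^ k = ⟨1, 0⟩ ∨ k % 6 = 1 ∧ alpha ^ k = ⟨0, 1⟩ ∨
    k % 6 = 2 ∧ alpha ^ k = ⟨-1, 1⟩ ∨ k % 6 = 3 ∧ alpha ^ k = ⟨-1, 0⟩ ∨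
    k % 6 = 4 ∧ alpha ^ k = ⟨0, -1⟩ ∨ k % 6 = 5 ∧ alpha ^ k = ⟨1, -1⟩ := by
  rw [alpha_pow_mod]
  have h : k % 6 < 6 := Nat.mod_lt _ (by norm_num)
  interval_cases k % 6 <;> decide

/-- The face with vertices `z`, `z + 1`, `z + α`. -/
def up (z : Eisenstein) : Finset Eisenstein := {z, z + 1, z + alpha}

/-- The face with vertices `z`, `z + α`, `z + α²`. -/
def down (z : Eisenstein) : Finset Eisenstein := {z, z + alpha, z + alpha ^ 2}

/-- The horizontal edge with left endpoint `z`. -/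
def horizontal (z : Eisenstein) : Finset Eisenstein := {z, z + 1}

theorem mem_up {z w : Eisenstein} : w ∈ up z ↔
    (w.re = z.re ∧ w.im = z.im) ∨ (w.re = z.re + 1 ∧ w.im = z.im) ∨
      (w.re = z.re ∧ w.im = z.im + 1) := by
  simp [up, QuadraticAlgebra.ext_iff, alpha]

theorem mem_down {z w : Eisenstein} : w ∈ down z ↔
    (w.re = z.re ∧ w.im = z.im) ∨ (w.re = z.re ∧ w.im = z.im + 1) ∨
      (w.re = z.re - 1 ∧ w.im = z.im + 1) := by
  rw [down, alpha_pow_two]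
  simp [QuadraticAlgebra.ext_iff, alpha, sub_eq_add_neg]

theorem mem_horizontal {z w : Eisenstein} : w ∈ horizontal z ↔
    (w.re = z.re ∧ w.im = z.im) ∨ (w.re = z.re + 1 ∧ w.im = z.im) := by
  simp [horizontal, QuadraticAlgebra.ext_iff]

theorem up_mem_faces (z : Eisenstein) : up z ∈ faces := ⟨z, 0, by simp [up]⟩

theorem down_mem_faces (z : Eisenstein) : down z ∈ faces := ⟨z, 1, by simp [down]⟩

theorem horizontal_mem_edges (z : Eisenstein) : horizontal z ∈ edges := ⟨z, 0, by simp [horizontal]⟩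

theorem eq_up_or_eq_down {t : Finset Eisenstein} (ht : t ∈ faces) :
    ∃ z, t = up z ∨ t = down z := by
  obtain ⟨z, k, rfl⟩ := ht
  rw [pow_succ]
  rcases alpha_pow_cases k with ⟨-, h⟩ | ⟨-, h⟩ | ⟨-, h⟩ | ⟨-, h⟩ | ⟨-, h⟩ | ⟨-, h⟩
  · refine ⟨z, .inl ?_⟩
    ext w
    simp only [mem_up, Finset.mem_insert, Finset.mem_singleton, h, QuadraticAlgebra.ext_iff]
    simp [alpha]
  · refine ⟨z, .inr ?_⟩
    ext w
    simp only [mem_down, Finset.mem_insert, Finset.mem_singleton, h, QuadraticAlgebra.ext_iff]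
    simp [alpha]
    omega
  · refine ⟨z - 1, .inl ?_⟩
    ext w
    simp only [mem_up, Finset.mem_insert, Finset.mem_singleton, h, QuadraticAlgebra.ext_iff]
    simp [alpha]
    omega
  · refine ⟨z - alpha, .inr ?_⟩
    ext w
    simp only [mem_down, Finset.mem_insert, Finset.mem_singleton, h, QuadraticAlgebra.ext_iff]
    simp [alpha]
    omega
  · refine ⟨z - alpha, .inl ?_⟩
    ext w
    simp only [mem_up, Finset.mem_insert, Finset.mem_singleton, h, QuadraticAlgebra.ext_iff]
    simp [alpha]
    omega
  · refine ⟨z + ⟨1, -1⟩, .inr ?_⟩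
    ext w
    simp only [mem_down, Finset.mem_insert, Finset.mem_singleton, h, QuadraticAlgebra.ext_iff]
    simp [alpha]
    omega

theorem up_injective : Function.Injective up := by
  intro z w h
  have h1 : z ∈ up w := h ▸ by simp [up]
  have h2 : w ∈ up z := h ▸ by simp [up]
  rw [mem_up] at h1 h2
  ext <;> omega

theorem down_injective : Function.Injective down := by
  intro z w h
  have h1 : z ∈ down w := h ▸ by simp [down]
  have h2 : w ∈ down z := h ▸ by simp [down]
  rw [mem_down] at h1 h2
  ext <;> omega

theorem up_ne_down (z w : Eisenstein) : up z ≠ down w := by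
  intro h
  have h0 : z ∈ down w := h ▸ by simp [up]
  have h1 : z + 1 ∈ down w := h ▸ by simp [up]
  have h2 : z + alpha ∈ down w := h ▸ by simp [up]
  rw [mem_down] at h0 h1 h2
  simp [alpha] at h0 h1 h2
  omega

theorem eq_of_horizontal_subset {z : Eisenstein} {t : Finset Eisenstein} (ht : t ∈ faces)
    (h : horizontal z ⊆ t) : t = up z ∨ t = down (z + ⟨1, -1⟩) := by
  have h0 : z ∈ t := h (by simp [horizontal])
  have h1 : z + 1 ∈ t := h (by simp [horizontal])
  obtain ⟨w, rfl | rfl⟩ := eq_up_or_eq_down ht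
  · left
    rw [mem_up] at h0 h1
    congr 1
    simp at h0 h1
    ext <;> omega
  · right
    rw [mem_down] at h0 h1
    congr 1
    simp at h0 h1
    ext <;> simp <;> omega

theorem horizontal_subset_up (z : Eisenstein) : horizontal z ⊆ up z := by
  intro w; rw [mem_horizontal, mem_up]; tauto

theorem horizontal_subset_down (z : Eisenstein) : horizontal z ⊆ down (z + ⟨1, -1⟩) := by
  intro w; rw [mem_horizontal, mem_down]; simp; omega

theorem vadd_up (w z : Eisenstein) : w +ᵥ up z = up (w + z) := by
  simp [up, Finset.vadd_finset_insert, add_assoc]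

theorem vadd_down (w z : Eisenstein) : w +ᵥ down z = down (w + z) := by
  simp [down, Finset.vadd_finset_insert, add_assoc]

theorem vadd_horizontal (w z : Eisenstein) : w +ᵥ horizontal z = horizontal (w + z) := by
  simp [horizontal, Finset.vadd_finset_insert, add_assoc]

theorem image_alpha_up (z : Eisenstein) : (up z).image (alpha * ·) = down (alpha * z) := by
  simp [up, down, Finset.image_insert, mul_add, pow_two]

theorem image_alpha_down (z : Eisenstein) :
    (down z).image (alpha * ·) = up (alpha * z - 1) := by
  have h : alpha * alpha ^ 2 = -1 := by decide
  have h2 : alpha * alpha = -1 + alpha := by decide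
  ext w
  simp only [up, down, Finset.image_insert, mul_add, h, h2, Finset.mem_insert,
    Finset.image_singleton, Finset.mem_singleton]
  rw [sub_add_cancel, ← add_assoc, ← sub_eq_add_neg]
  tauto

/-! ### Trapezoids and necklaces as linear inequalities -/

/-- The real coordinates of an Eisenstein integer with respect to the basis `1`, `α`. -/
def coords (z : Eisenstein) : ℝ × ℝ := (z.re, z.im)

/-- The linear parametrization of the plane by coordinates with respect to the basis `1`, `α`. -/
noncomputable def plane : ℝ × ℝ →ₗ[ℝ] ℂ where
  toFun p := (p.1 : ℂ) + (p.2 : ℂ) * ((1 + Complex.I * (Real.sqrt 3 : ℂ)) / 2)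
  map_add' p q := by simp; ring
  map_smul' c p := by simp; ring

theorem plane_injective : Function.Injective plane := by
  rw [injective_iff_map_eq_zero]
  intro p h
  have h1 := congrArg Complex.re h
  have h2 := congrArg Complex.im h
  simp [plane] at h1 h2
  rw [h2] at h1
  ext
  · simpa using h1
  · exact h2

theorem plane_coords (z : Eisenstein) : plane (coords z) = toComplex z := by
  simp [plane, coords, toComplex]

theorem toComplex_mem_convexHull (t : Fin 4 → Eisenstein) (z : Eisenstein) :
    toComplex z ∈ convexHull ℝ (Set.range fun i => toComplex (t i)) ↔
      coords z ∈ convexHull ℝ (Set.range (coords ∘ t)) := by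
  have : (Set.range fun i => toComplex (t i)) = plane '' Set.range (coords ∘ t) := by
    rw [← Set.range_comp]
    congr 1
  rw [this, ← LinearMap.image_convexHull, ← plane_coords,
    plane_injective.mem_set_image]

theorem coords_mem_standardTrapezoid {p q : ℤ} (hp : 0 < p) (hpq : p ≤ q) (z : Eisenstein) :
    coords z ∈ convexHull ℝ (Set.range (coords ∘ standardTrapezoid p q)) ↔
      q - p ≤ z.im ∧ z.im ≤ q ∧ z.re ≤ p ∧ p ≤ z.re + z.im := by
  have hp' : (0 : ℝ) < p := by exact_mod_cast hp
  have hpq' : (p : ℝ) ≤ q := by exact_mod_cast hpq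
  constructor
  · intro h
    let H : Set (ℝ × ℝ) := {c | (q : ℝ) - p ≤ c.2 ∧ c.2 ≤ q ∧ c.1 ≤ p ∧ (p : ℝ) ≤ c.1 + c.2}
    have hH : Convex ℝ H := by
      intro c hc d hd s t hs ht hst
      simp only [H, Set.mem_ofPred_eq, Prod.fst_add, Prod.snd_add, Prod.smul_fst, Prod.smul_snd,
        smul_eq_mul] at hc hd ⊢
      obtain rfl : t = 1 - s := by linarith
      refine ⟨?_, ?_, ?_, ?_⟩ <;> nlinarith
    have hsub : convexHull ℝ (Set.range (coords ∘ standardTrapezoid p q)) ⊆ H := by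
      refine convexHull_min ?_ hH
      rintro _ ⟨i, rfl⟩
      fin_cases i <;>
        simp [H, coords, standardTrapezoid] <;> (try constructorm* _ ∧ _) <;> linarith
    obtain ⟨h1, h2, h3, h4⟩ := hsub h
    simp only [coords] at h1 h2 h3 h4
    exact ⟨by exact_mod_cast h1, by exact_mod_cast h2, by exact_mod_cast h3, by exact_mod_cast h4⟩
  · rintro ⟨h1, h2, h3, h4⟩
    have h1' : (q : ℝ) - p ≤ z.im := by exact_mod_cast h1
    have h2' : (z.im : ℝ) ≤ q := by exact_mod_cast h2
    have h3' : (z.re : ℝ) ≤ p := by exact_mod_cast h3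
    have h4' : (p : ℝ) ≤ z.re + z.im := by exact_mod_cast h4
    set C := convexHull ℝ (Set.range (coords ∘ standardTrapezoid p q)) with hC
    have hconv : Convex ℝ C := convex_convexHull _ _
    have hv : ∀ i, coords (standardTrapezoid p q i) ∈ C :=
      fun i => subset_convexHull _ _ ⟨i, rfl⟩
    have v0 := hv 0
    have v1 := hv 1
    have v2 := hv 2
    have v3 := hv 3
    simp [coords, standardTrapezoid] at v0 v1 v2 v3
    -- The horizontal line through the point meets the two diagonal sides in `(p, v)`, `(p - v, v)`.
    set s : ℝ := (z.im - (q - p)) / p with hs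
    have hs0 : 0 ≤ s := div_nonneg (by linarith) hp'.le
    have hs1 : s ≤ 1 := (div_le_one hp').2 (by linarith)
    have hsp : s * p = z.im - (q - p) := by rw [hs]; field_simp
    have e1 : ((p : ℝ), (z.im : ℝ)) ∈ C := by
      have := hconv v0 v3 hs0 (sub_nonneg.2 hs1) (by ring)
      convert this using 1
      ext <;> simp <;> linarith
    have e2 : ((p : ℝ) - z.im, (z.im : ℝ)) ∈ C := by
      have := hconv v1 v2 hs0 (sub_nonneg.2 hs1) (by ring)
      convert this using 1
      ext <;> simp <;> linarith
    rcases eq_or_lt_of_le (show (0 : ℝ) ≤ z.im by linarith) with h0 | h0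
    · have : coords z = ((p : ℝ), (z.im : ℝ)) := by
        refine Prod.ext ?_ rfl
        simp only [coords]
        linarith
      rw [this]; exact e1
    · set r : ℝ := (z.re - (p - z.im)) / z.im with hr
      have hr0 : 0 ≤ r := div_nonneg (by linarith) h0.le
      have hr1 : r ≤ 1 := (div_le_one h0).2 (by linarith)
      have hrp : r * z.im = z.re - (p - z.im) := by rw [hr]; field_simp
      have := hconv e1 e2 hr0 (sub_nonneg.2 hr1) (by ring)
      convert this using 1
      ext <;> simp [coords] <;> linarith

/-- The linear inequalities which cut out the trapezoid with outer vertex `x + y α`. -/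
def InTrapezoid (x y u v : ℤ) : Prop :=
  (x ≤ y → y - x ≤ v ∧ v ≤ y ∧ u ≤ x ∧ x ≤ u + v) ∧
  (y < x → x - y ≤ u ∧ u ≤ x ∧ v ≤ y ∧ y ≤ u + v)

theorem toComplex_mem_trapezoidRegion {x y : ℤ} (hx : 0 < x) (hy : 0 < y) (z : Eisenstein) :
    toComplex z ∈ trapezoidRegion x y ↔ InTrapezoid x y z.re z.im := by
  rw [trapezoidRegion, toComplex_mem_convexHull]
  by_cases h : x ≤ y
  · have : trapezoid x y = standardTrapezoid x y := by simp [trapezoid, h]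
    change coords z ∈ convexHull ℝ (Set.range (coords ∘ trapezoid x y)) ↔ _
    rw [this, coords_mem_standardTrapezoid hx h]
    simp [InTrapezoid, h, not_lt.2 h]
  · have ht : trapezoid x y = mirror ∘ standardTrapezoid y x := by simp [trapezoid, h]
    change coords z ∈ convexHull ℝ (Set.range (coords ∘ trapezoid x y)) ↔ _
    have : Set.range (coords ∘ trapezoid x y) = (LinearEquiv.prodComm ℝ ℝ ℝ).toLinearMap ''
        Set.range (coords ∘ standardTrapezoid y x) := by
      rw [← Set.range_comp, ht]
      rfl
    rw [this, ← LinearMap.image_convexHull]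
    have hz : coords z = (LinearEquiv.prodComm ℝ ℝ ℝ).toLinearMap (coords (mirror z)) := rfl
    have hinj : Function.Injective (LinearEquiv.prodComm ℝ ℝ ℝ).toLinearMap :=
      (LinearEquiv.prodComm ℝ ℝ ℝ).injective
    rw [hz, hinj.mem_set_image, coords_mem_standardTrapezoid hy (le_of_not_ge h)]
    simp [InTrapezoid, h, not_le.1 h, mirror, add_comm]

/-- The face `up ⟨u, v⟩` belongs to the solid flower (the region inside the necklace with outer
vertex `x + y α`). The boundary of that region has a reflex vertex `(x - y) + y α`; the wedge
`y ≤ v`, `x ≤ u + v` is spanned by the two boundary segments at this vertex, and the solid flower is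
the complement of the six images of this wedge under the rotations by `α ^ k`. -/
def UpIn (x y u v : ℤ) : Prop :=
  ¬(y ≤ v ∧ x ≤ u + v) ∧ ¬(y ≤ u + v ∧ x ≤ u) ∧ ¬(y ≤ u ∧ x ≤ -v - 1) ∧
  ¬(y ≤ -v - 1 ∧ x ≤ -u - v - 1) ∧ ¬(y ≤ -u - v - 1 ∧ x ≤ -u - 1) ∧ ¬(y ≤ -u - 1 ∧ x ≤ v)

/-- The face `down ⟨u, v⟩` belongs to the solid flower; it is rotated to `up ⟨-v - 1, u + v⟩`
by `α`. -/
def DownIn (x y u v : ℤ) : Prop := UpIn x y (-v - 1) (u + v)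

theorem up_mem_necklace_iff {x y : ℤ} (hx : 0 < x) (hy : 0 < y) {u v : ℤ} :
    up ⟨u, v⟩ ∈ necklace x y ↔
      (InTrapezoid x y u v ∧ InTrapezoid x y (u + 1) v ∧ InTrapezoid x y u (v + 1)) ∨
      (InTrapezoid x y (-v) (u + v) ∧ InTrapezoid x y (-v) (u + v + 1) ∧
        InTrapezoid x y (-v - 1) (u + v + 1)) ∨
      (InTrapezoid x y (-u - v) u ∧ InTrapezoid x y (-u - v - 1) (u + 1) ∧
        InTrapezoid x y (-u - v - 1) u) ∨
      (InTrapezoid x y (-u) (-v) ∧ InTrapezoid x y (-u - 1) (-v) ∧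
        InTrapezoid x y (-u) (-v - 1)) ∨
      (InTrapezoid x y v (-u - v) ∧ InTrapezoid x y v (-u - v - 1) ∧
        InTrapezoid x y (v + 1) (-u - v - 1)) ∨
      (InTrapezoid x y (u + v) (-u) ∧ InTrapezoid x y (u + v + 1) (-u - 1) ∧
        InTrapezoid x y (u + v + 1) (-u)) := by
  have key : up ⟨u, v⟩ ∈ necklace x y ↔ ∃ k : ℕ, ∀ w ∈ up (⟨u, v⟩ : Eisenstein),
      InTrapezoid x y (alpha ^ k * w).re (alpha ^ k * w).im := by
    simp only [necklace, Set.mem_ofPred_eq, up_mem_faces, true_and,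
      toComplex_mem_trapezoidRegion hx hy]
  rw [key]
  simp only [up, Finset.forall_mem_insert, Finset.mem_singleton, forall_eq]
  constructor
  · rintro ⟨k, hk⟩
    rcases alpha_pow_cases k with ⟨-, h⟩ | ⟨-, h⟩ | ⟨-, h⟩ | ⟨-, h⟩ | ⟨-, h⟩ | ⟨-, h⟩ <;>
      rw [h] at hk
    · refine .inl ?_
      convert! hk using 3 <;> simp [alpha]
    · refine .inr (.inl ?_)
      convert! hk using 3 <;> simp [alpha] <;> ring
    · refine .inr (.inr (.inl ?_))
      convert! hk using 3 <;> simp [alpha] <;> ring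
    · refine .inr (.inr (.inr (.inl ?_)))
      convert! hk using 3 <;> simp [alpha] <;> ring
    · refine .inr (.inr (.inr (.inr (.inl ?_))))
      convert! hk using 3 <;> simp [alpha] <;> ring
    · refine .inr (.inr (.inr (.inr (.inr ?_))))
      convert! hk using 3 <;> simp [alpha] <;> ring
  · rintro (h | h | h | h | h | h)
    · refine ⟨0, ?_⟩
      convert! h using 3 <;> simp [alpha]
    · refine ⟨1, ?_⟩
      convert! h using 3 <;> simp [alpha] <;> ring
    · refine ⟨2, ?_⟩
      rw [alpha_pow_two]
      convert! h using 3 <;> simp [alpha] <;> ring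
    · refine ⟨3, ?_⟩
      rw [alpha_pow_three]
      convert! h using 3 <;> simp [alpha] <;> ring
    · refine ⟨4, ?_⟩
      rw [alpha_pow_four]
      convert! h using 3 <;> simp [alpha] <;> ring
    · refine ⟨5, ?_⟩
      rw [alpha_pow_five]
      convert! h using 3 <;> simp [alpha] <;> ring

/-! ### Solid flowers and their boundaries -/

/-- One step of the subtractive Euclidean algorithm. -/
def euclid {R : Type*} [Sub R] [LT R] [DecidableLT R] (p : R × R) : R × R :=
  if p.1 < p.2 then (p.1, p.2 - p.1) else (p.1 - p.2, p.2)

theorem up_mem_necklace_iff_of_lt {x y : ℤ} (hx : 0 < x) (hxy : x < y) {u v : ℤ} :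
    up ⟨u, v⟩ ∈ necklace x y ↔ UpIn x y u v ∧ ¬ UpIn x (y - x) u v := by
  rw [up_mem_necklace_iff hx (hx.trans hxy)]
  simp only [InTrapezoid, hxy.le, hxy.not_gt, true_imp_iff, false_imp_iff, and_true]
  constructor
  · rintro (h | h | h | h | h | h) <;> simp only [UpIn] <;> refine ⟨?_, ?_⟩ <;> omega
  · rintro ⟨h, h'⟩
    simp only [UpIn] at h
    rw [UpIn] at h'
    by_contra H
    rw [not_or, not_or, not_or, not_or, not_or] at H
    obtain ⟨H1, H2, H3, H4, H5, H6⟩ := H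
    refine h' ⟨fun h1 => H1 ?_, fun h1 => H2 ?_, fun h1 => H3 ?_, fun h1 => H4 ?_,
      fun h1 => H5 ?_, fun h1 => H6 ?_⟩ <;> clear h' H1 H2 H3 H4 H5 H6 <;> omega

theorem up_mem_necklace_iff_of_gt {x y : ℤ} (hy : 0 < y) (hxy : y < x) {u v : ℤ} :
    up ⟨u, v⟩ ∈ necklace x y ↔ UpIn x y u v ∧ ¬ UpIn (x - y) y u v := by
  rw [up_mem_necklace_iff (hy.trans hxy) hy]
  simp only [InTrapezoid, hxy, hxy.not_ge, true_imp_iff, false_imp_iff, true_and]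
  constructor
  · rintro (h | h | h | h | h | h) <;> simp only [UpIn] <;> refine ⟨?_, ?_⟩ <;> omega
  · rintro ⟨h, h'⟩
    simp only [UpIn] at h
    rw [UpIn] at h'
    by_contra H
    rw [not_or, not_or, not_or, not_or, not_or] at H
    obtain ⟨H1, H2, H3, H4, H5, H6⟩ := H
    refine h' ⟨fun h1 => H6 ?_, fun h1 => H1 ?_, fun h1 => H2 ?_, fun h1 => H3 ?_,
      fun h1 => H4 ?_, fun h1 => H5 ?_⟩ <;> clear h' H1 H2 H3 H4 H5 H6 <;> omega

theorem up_mem_necklace_one {u v : ℤ} :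
    up ⟨u, v⟩ ∈ necklace 1 1 ↔ UpIn 1 1 u v ∧ ¬ UpIn 0 1 u v := by
  rw [up_mem_necklace_iff one_pos one_pos]
  simp only [InTrapezoid, le_refl, lt_irrefl, true_imp_iff, false_imp_iff, and_true]
  constructor
  · rintro (h | h | h | h | h | h) <;> simp only [UpIn] <;> refine ⟨?_, ?_⟩ <;> omega
  · rintro ⟨h, h'⟩
    simp only [UpIn] at h
    rw [UpIn] at h'
    by_contra H
    rw [not_or, not_or, not_or, not_or, not_or] at H
    obtain ⟨H1, H2, H3, H4, H5, H6⟩ := H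
    refine h' ⟨fun h1 => H6 ?_, fun h1 => H1 ?_, fun h1 => H2 ?_, fun h1 => H3 ?_,
      fun h1 => H4 ?_, fun h1 => H5 ?_⟩ <;> clear h' H1 H2 H3 H4 H5 H6 <;> omega

/-- The pairs occurring as outer vertices of the layers of a flower: coprime pairs of positive
integers, and the pair `(0, 1)` at which the subtractive Euclidean algorithm comes to rest. -/
def Admissible (p : ℤ × ℤ) : Prop :=
  (0 < p.1 ∧ 0 < p.2 ∧ IsCoprime p.1 p.2) ∨ p = (0, 1)

theorem eq_one_of_isCoprime_self {x : ℤ} (hx : 0 < x) (h : IsCoprime x x) : x = 1 := by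
  have := Int.isUnit_iff.1 (isCoprime_self.1 h)
  omega

theorem Admissible.euclid {p : ℤ × ℤ} (hp : Admissible p) : Admissible (euclid p) := by
  obtain ⟨x, y⟩ := p
  rcases hp with ⟨hx, hy, h⟩ | h
  · simp only at hx hy h
    simp only [Eisenstein.euclid]
    split_ifs with hxy
    · left
      refine ⟨hx, by simpa using hxy, ?_⟩
      simpa using h.add_mul_left_right (-1) |> fun h => by simpa [sub_eq_add_neg] using h
    · rcases eq_or_lt_of_le (not_lt.1 hxy) with rfl | hlt
      · right
        simp [eq_one_of_isCoprime_self hx h]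
      · left
        refine ⟨by simpa using hlt, hy, ?_⟩
        simpa using h.add_mul_left_left (-1) |> fun h => by simpa [sub_eq_add_neg] using h
  · right
    rw [h]
    decide

/-- The layer with outer vertex `x + y α` consists of the faces of the solid flower which are not in
the solid flower inside it. -/
theorem up_mem_necklace {p : ℤ × ℤ} (hp : Admissible p) (hx : 0 < p.1) {u v : ℤ} :
    up ⟨u, v⟩ ∈ necklace p.1 p.2 ↔
      UpIn p.1 p.2 u v ∧ ¬ UpIn (euclid p).1 (euclid p).2 u v := by
  obtain ⟨x, y⟩ := p
  rcases hp with ⟨hx, hy, h⟩ | h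
  · simp only at hx hy h
    simp only [euclid]
    split_ifs with hxy
    · exact up_mem_necklace_iff_of_lt hx hxy
    · rcases eq_or_lt_of_le (not_lt.1 hxy) with rfl | hlt
      · obtain rfl := eq_one_of_isCoprime_self hx h
        exact up_mem_necklace_one
      · exact up_mem_necklace_iff_of_gt hy hlt
  · rw [h] at hx
    exact absurd hx (by simp)

theorem necklace_alpha {x y : ℤ} {t : Finset Eisenstein} (ht : t ∈ faces) :
    t.image (alpha * ·) ∈ necklace x y ↔ t ∈ necklace x y := by
  have hf : t.image (alpha * ·) ∈ faces := by
    obtain ⟨z, rfl | rfl⟩ := eq_up_or_eq_down ht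
    · rw [image_alpha_up]; exact down_mem_faces _
    · rw [image_alpha_down]; exact up_mem_faces _
  simp only [necklace, Set.mem_ofPred_eq, hf, ht, true_and, Finset.forall_mem_image]
  constructor
  · rintro ⟨k, hk⟩
    exact ⟨k + 1, fun v hv => by simpa [pow_succ, mul_assoc] using hk hv⟩
  · rintro ⟨k, hk⟩
    refine ⟨k + 5, fun v hv => ?_⟩
    have : alpha ^ (k + 5) * (alpha * v) = alpha ^ k * v := by
      rw [pow_add, mul_assoc, ← mul_assoc (alpha ^ 5), ← pow_succ, alpha_pow_six, one_mul]
    rw [this]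
    exact hk v hv

theorem down_mem_necklace {p : ℤ × ℤ} (hp : Admissible p) (hx : 0 < p.1) {u v : ℤ} :
    down ⟨u, v⟩ ∈ necklace p.1 p.2 ↔
      DownIn p.1 p.2 u v ∧ ¬ DownIn (euclid p).1 (euclid p).2 u v := by
  have : alpha * (⟨u, v⟩ : Eisenstein) - 1 = ⟨-v - 1, u + v⟩ := by
    ext <;> simp [alpha]
  rw [← necklace_alpha (down_mem_faces _), image_alpha_down, this, up_mem_necklace hp hx]
  rfl

theorem UpIn.of_euclid {x y : ℤ} (hx : 0 ≤ x) (hy : 0 ≤ y) {u v : ℤ}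
    (h : UpIn (euclid (x, y)).1 (euclid (x, y)).2 u v) : UpIn x y u v := by
  simp only [euclid] at h
  split_ifs at h <;> simp only [UpIn] at h ⊢ <;> omega

/-- The horizontal edge `horizontal ⟨u, v⟩` lies on the boundary of the solid flower with outer
vertex `x + y α`. -/
def OnBoundary (x y u v : ℤ) : Prop :=
  (v = y ∧ x - y ≤ u ∧ u < x) ∨ (v = -y ∧ x - y ≤ -u - 1 ∧ -u - 1 < x) ∨
  (v = -x ∧ y ≤ u ∧ u < x + y) ∨ (v = x ∧ y ≤ -u - 1 ∧ -u - 1 < x + y)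

/-- The boundary of a solid flower consists of the edges with one face inside and one outside. -/
theorem onBoundary_iff {x y : ℤ} (hx : 0 ≤ x) (hy : 0 < y) {u v : ℤ} :
    OnBoundary x y u v ↔ ¬ (UpIn x y u v ↔ DownIn x y (u + 1) (v - 1)) := by
  by_cases h : OnBoundary x y u v
  · simp only [h, true_iff]
    rcases h with h | h | h | h
    · have h1 : ¬ UpIn x y u v := by simp only [UpIn]; omega
      have h2 : DownIn x y (u + 1) (v - 1) := by simp only [DownIn, UpIn]; omega
      tauto
    · have h1 : UpIn x y u v := by simp only [UpIn]; omega
      have h2 : ¬ DownIn x y (u + 1) (v - 1) := by simp only [DownIn, UpIn]; omega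
      tauto
    · have h1 : UpIn x y u v := by simp only [UpIn]; omega
      have h2 : ¬ DownIn x y (u + 1) (v - 1) := by simp only [DownIn, UpIn]; omega
      tauto
    · have h1 : ¬ UpIn x y u v := by simp only [UpIn]; omega
      have h2 : DownIn x y (u + 1) (v - 1) := by simp only [DownIn, UpIn]; omega
      tauto
  · simp only [h, false_iff, not_not]
    simp only [OnBoundary] at h
    simp only [DownIn, UpIn]
    omega

/-- The faces on both sides of the inner boundary of a layer belong to the solid flower bounded by
the outer boundary of this layer. -/
theorem OnBoundary.of_euclid {x y : ℤ} (hx : 0 < x) (hy : 0 < y) {u v : ℤ}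
    (h : OnBoundary (euclid (x, y)).1 (euclid (x, y)).2 u v) :
    UpIn x y u v ∧ DownIn x y (u + 1) (v - 1) := by
  simp only [euclid] at h
  split_ifs at h <;> simp only [OnBoundary, DownIn, UpIn] at h ⊢ <;> omega

/-! ### The orbits of the group of rotations -/

theorem mem_rotationGroup {β : Eisenstein} {g : Equiv.Perm Eisenstein} (hg : g ∈ rotationGroup β) :
    ∃ (i : ℕ) (u : Eisenstein), ∀ z, g z = (1 + alpha) * β * u + alpha ^ (2 * i) * z := by
  induction hg using Subgroup.closure_induction with
  | mem g hg =>
    obtain ⟨w, rfl⟩ := hg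
    refine ⟨1, (1 - alpha) * w, fun z => ?_⟩
    simp only [rotation, Equiv.coe_fn_mk]
    ring
  | one => exact ⟨0, 0, fun z => by simp⟩
  | mul g h _ _ hg hh =>
    obtain ⟨i, u, hg⟩ := hg
    obtain ⟨j, v, hh⟩ := hh
    refine ⟨i + j, u + alpha ^ (2 * i) * v, fun z => ?_⟩
    rw [Equiv.Perm.mul_apply, hh, hg]
    ring
  | inv g _ hg =>
    obtain ⟨i, u, hg⟩ := hg
    refine ⟨2 * i, -(alpha ^ (2 * (2 * i)) * u), fun z => ?_⟩
    rw [Equiv.Perm.inv_eq_iff_eq, hg]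
    have h : alpha ^ (2 * i) * alpha ^ (2 * (2 * i)) = 1 := by
      rw [← pow_add, show 2 * i + 2 * (2 * i) = 6 * i by ring, pow_mul, alpha_pow_six, one_pow]
    linear_combination ((1 + alpha) * β * u - z) * h

theorem rotation_zero_mem (β : Eisenstein) : rotation 0 ∈ rotationGroup β :=
  Subgroup.subset_closure ⟨0, by simp⟩

theorem exists_translation_mem (β u : Eisenstein) :
    ∃ g ∈ rotationGroup β, ∀ z, g z = (1 + alpha) * β * u + z := by
  refine ⟨rotation (β * (alpha * u)) * (rotation 0)⁻¹,
    mul_mem (Subgroup.subset_closure ⟨_, rfl⟩) (inv_mem (rotation_zero_mem β)), fun z => ?_⟩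
  obtain ⟨z, rfl⟩ := (rotation 0).surjective z
  rw [Equiv.Perm.mul_apply,
    show (rotation 0)⁻¹ (rotation 0 z) = z from (rotation 0).symm_apply_apply z]
  simp only [rotation, Equiv.coe_fn_mk]
  have h3 : alpha ^ 3 = -1 := by decide
  linear_combination (- β * u) * h3

/-- The group `G_β` consists of the maps `z ↦ (1 + α) β u + α ^ (2 i) z`. -/
theorem toQuotient_eq_iff {β : Eisenstein} {s t : Finset Eisenstein} :
    toQuotient β s = toQuotient β t ↔
      ∃ (i : ℕ) (u : Eisenstein), s = ((1 + alpha) * β * u) +ᵥ t.image (alpha ^ (2 * i) * ·) := by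
  rw [toQuotient, toQuotient, Quotient.eq'', MulAction.orbitRel_apply, MulAction.mem_orbit_iff]
  constructor
  · rintro ⟨⟨g, hg⟩, rfl⟩
    obtain ⟨i, u, h⟩ := mem_rotationGroup hg
    refine ⟨i, u, ?_⟩
    ext w
    simp only [Subgroup.mk_smul, Finset.mem_smul_finset, Finset.mem_vadd_finset, Finset.mem_image,
      Equiv.Perm.smul_def, h, vadd_eq_add, exists_exists_and_eq_and]
  · rintro ⟨i, u, rfl⟩
    obtain ⟨g, hg, h⟩ := exists_translation_mem β u
    refine ⟨⟨g * rotation 0 ^ i, mul_mem hg (pow_mem (rotation_zero_mem β) i)⟩, ?_⟩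
    have hr : ∀ z, (rotation 0 ^ i) z = alpha ^ (2 * i) * z := by
      intro z
      induction i with
      | zero => simp
      | succ i ih =>
        rw [pow_succ', Equiv.Perm.mul_apply, ih]
        simp only [rotation, Equiv.coe_fn_mk]
        ring
    ext w
    simp only [Subgroup.mk_smul, Finset.mem_smul_finset, Finset.mem_vadd_finset, Finset.mem_image,
      Equiv.Perm.smul_def, h, hr, vadd_eq_add, exists_exists_and_eq_and, Equiv.Perm.mul_apply]

theorem image_mul_eq_self {c : Eisenstein} (hc : c = 1) (t : Finset Eisenstein) :
    t.image (c * ·) = t := by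
  simp [hc]

theorem image_image_mul (c d : Eisenstein) (t : Finset Eisenstein) :
    (t.image (c * ·)).image (d * ·) = t.image (d * c * ·) := by
  simp [Finset.image_image, Function.comp_def, mul_assoc]

theorem image_vadd (c w : Eisenstein) (t : Finset Eisenstein) :
    (w +ᵥ t).image (c * ·) = (c * w) +ᵥ t.image (c * ·) := by
  ext v
  simp [Finset.mem_vadd_finset, mul_add]

theorem image_mem_faces {t : Finset Eisenstein} (ht : t ∈ faces) :
    t.image (alpha * ·) ∈ faces := by
  obtain ⟨z, rfl | rfl⟩ := eq_up_or_eq_down ht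
  · rw [image_alpha_up]; exact down_mem_faces _
  · rw [image_alpha_down]; exact up_mem_faces _

theorem image_sq_eq (t : Finset Eisenstein) :
    t.image (alpha ^ 2 * ·) = (t.image (alpha * ·)).image (alpha * ·) := by
  rw [image_image_mul, pow_two]

theorem flowerBlack_subset_faces (β : Eisenstein) : flowerBlack β ⊆ faces := by
  rintro t (⟨k, x, y, -, -, h⟩ | ⟨k, -, rfl⟩)
  · exact h.1
  · exact ⟨0, k, by simp⟩

theorem image_sq_mem_flowerBlack {β : Eisenstein} {t : Finset Eisenstein}
    (ht : t ∈ flowerBlack β) : t.image (alpha ^ 2 * ·) ∈ flowerBlack β := by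
  have hf := flowerBlack_subset_faces β ht
  rcases ht with ⟨k, x, y, hk, hl, h⟩ | ⟨k, hk, rfl⟩
  · refine .inl ⟨k, x, y, hk, hl, ?_⟩
    rwa [image_sq_eq, necklace_alpha (image_mem_faces hf), necklace_alpha hf]
  · refine .inr ⟨k + 2, hk.add (by decide), ?_⟩
    simp only [Finset.image_insert, mul_zero, Finset.image_singleton, ← pow_add]
    rw [show 2 + k = k + 2 by ring, show 2 + (k + 1) = k + 2 + 1 by ring]

theorem image_sq_mem_blackFaces {β : Eisenstein} {t : Finset Eisenstein}
    (ht : t ∈ blackFaces β) : t.image (alpha ^ 2 * ·) ∈ blackFaces β := by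
  obtain ⟨w, s, hs, rfl⟩ := ht
  refine ⟨alpha ^ 2 * w, _, image_sq_mem_flowerBlack hs, ?_⟩
  rw [image_vadd]
  congr 1
  ring

theorem image_sq_mem_blackFaces_iff {β : Eisenstein} {t : Finset Eisenstein} :
    t.image (alpha ^ 2 * ·) ∈ blackFaces β ↔ t ∈ blackFaces β := by
  refine ⟨fun h => ?_, image_sq_mem_blackFaces⟩
  have := image_sq_mem_blackFaces (image_sq_mem_blackFaces h)
  rw [image_image_mul, image_image_mul] at this
  rwa [image_mul_eq_self (by decide)] at this

theorem image_sq_mem_foldEdges {β : Eisenstein} {e : Finset Eisenstein}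
    (he : e ∈ foldEdges β) : e.image (alpha ^ 2 * ·) ∈ foldEdges β := by
  obtain ⟨⟨z, k, rfl⟩, s, hs, t, ht, hes, het, hsb, htb⟩ := he
  refine ⟨⟨alpha ^ 2 * z, k + 2, ?_⟩, _, ?_, _, ?_, Finset.image_subset_image hes,
    Finset.image_subset_image het, image_sq_mem_blackFaces hsb,
    mt image_sq_mem_blackFaces_iff.1 htb⟩
  · rw [add_comm k, pow_add]
    simp [mul_add]
  · rw [image_sq_eq]; exact image_mem_faces (image_mem_faces hs)
  · rw [image_sq_eq]; exact image_mem_faces (image_mem_faces ht)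

/-- Every edge is a horizontal edge up to a rotation by a power of `α²`. -/
theorem exists_image_eq_horizontal {e : Finset Eisenstein} (he : e ∈ edges) :
    ∃ i z, e.image (alpha ^ (2 * i) * ·) = horizontal z := by
  obtain ⟨z, k, rfl⟩ := he
  have aux : ∀ i, alpha ^ (2 * i) * alpha ^ k = 1 ∨ alpha ^ (2 * i) * alpha ^ k = -1 →
      ∃ i z', ({z, z + alpha ^ k} : Finset Eisenstein).image (alpha ^ (2 * i) * ·) =
        horizontal z' := by
    rintro i (h | h)
    · refine ⟨i, alpha ^ (2 * i) * z, ?_⟩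
      simp [mul_add, h, horizontal]
    · refine ⟨i, alpha ^ (2 * i) * z - 1, ?_⟩
      simp [mul_add, h, horizontal, ← sub_eq_add_neg, Finset.pair_comm]
  rcases alpha_pow_cases k with ⟨-, h⟩ | ⟨-, h⟩ | ⟨-, h⟩ | ⟨-, h⟩ | ⟨-, h⟩ | ⟨-, h⟩
  · exact aux 0 (by rw [h]; decide)
  · exact aux 1 (by rw [h]; decide)
  · exact aux 2 (by rw [h]; decide)
  · exact aux 0 (by rw [h]; decide)
  · exact aux 1 (by rw [h]; decide)
  · exact aux 2 (by rw [h]; decide)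

theorem image_pow_mem_foldEdges {β : Eisenstein} {e : Finset Eisenstein}
    (he : e ∈ foldEdges β) (i : ℕ) : e.image (alpha ^ (2 * i) * ·) ∈ foldEdges β := by
  induction i with
  | zero => simpa using he
  | succ i ih =>
    have := image_sq_mem_foldEdges ih
    rwa [image_image_mul, ← pow_add, show 2 + 2 * i = 2 * (i + 1) by ring] at this

theorem horizontal_mem_foldEdges_iff {β z : Eisenstein} :
    horizontal z ∈ foldEdges β ↔
      ¬ (up z ∈ blackFaces β ↔ down (z + ⟨1, -1⟩) ∈ blackFaces β) := by
  constructor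
  · rintro ⟨-, s, hs, t, ht, hes, het, hsb, htb⟩
    rcases eq_of_horizontal_subset hs hes with rfl | rfl <;>
      rcases eq_of_horizontal_subset ht het with rfl | rfl <;> tauto
  · intro h
    refine ⟨horizontal_mem_edges z, ?_⟩
    by_cases hb : up z ∈ blackFaces β
    · exact ⟨_, up_mem_faces z, _, down_mem_faces _, horizontal_subset_up z,
        horizontal_subset_down z, hb, by tauto⟩
    · exact ⟨_, down_mem_faces _, _, up_mem_faces z, horizontal_subset_down z,
        horizontal_subset_up z, by tauto, hb⟩

/-- Horizontal edges are equivalent under `G_β` only if they differ by a translation in `G_β`. -/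
theorem toQuotient_horizontal_eq {β z z' : Eisenstein}
    (h : toQuotient β (horizontal z) = toQuotient β (horizontal z')) :
    ∃ u, z = (1 + alpha) * β * u + z' := by
  obtain ⟨i, u, h⟩ := toQuotient_eq_iff.1 h
  refine ⟨u, ?_⟩
  have e1 : (1 + alpha) * β * u + alpha ^ (2 * i) * z' ∈ horizontal z := by
    rw [h]
    simp [horizontal, Finset.vadd_finset_insert]
  have e2 : (1 + alpha) * β * u + alpha ^ (2 * i) * (z' + 1) ∈ horizontal z := by
    rw [h]
    simp [horizontal, Finset.vadd_finset_insert]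
  have hne : alpha ^ (2 * i) ≠ 0 := by
    intro h0
    have : (alpha ^ (2 * i)) ^ 3 = 1 := by
      rw [← pow_mul, show 2 * i * 3 = 6 * i by ring, pow_mul, alpha_pow_six, one_pow]
    rw [h0] at this
    revert this
    decide
  rw [mul_add, mul_one, ← add_assoc] at e2
  simp only [horizontal, Finset.mem_insert, Finset.mem_singleton] at e1 e2
  rcases alpha_pow_cases (2 * i) with ⟨-, h'⟩ | ⟨hi, h'⟩ | ⟨-, h'⟩ | ⟨hi, h'⟩ | ⟨-, h'⟩ | ⟨hi, h'⟩
  · have h1 : alpha ^ (2 * i) = 1 := by rw [h']; rfl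
    rw [h1, one_mul] at e1 e2
    rcases e1 with e1 | e1
    · exact e1.symm
    · rw [e1] at e2
      rcases e2 with e2 | e2 <;> rw [QuadraticAlgebra.ext_iff] at e2 <;> simp at e2
      omega
  · omega
  · rw [h'] at e1 e2
    simp only [QuadraticAlgebra.ext_iff] at e1 e2
    simp at e1 e2
    omega
  · omega
  · rw [h'] at e1 e2
    simp only [QuadraticAlgebra.ext_iff] at e1 e2
    simp at e1 e2
    omega
  · omega

/-! ### Flowers are disjoint -/

/-- If the midpoint `(U + V α) / 2` of an edge satisfies one of these bounds (with `A = U + V` and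
`B = V`), it lies strictly on the inner side of a side of the hexagon with vertices `α ^ k β`. -/
theorem half_plane {x y A B : ℤ} (hx : 0 < x) (hy : 0 < y)
    (h : (A ≤ 2 * x ∧ B ≤ 2 * x + 2 * y - 1) ∨ (A ≤ 2 * x - 1 ∧ B ≤ 2 * x + 2 * y) ∨
      (A ≤ 2 * x + 2 * y ∧ B ≤ 2 * y - 1) ∨ (A ≤ 2 * x + 2 * y - 1 ∧ B ≤ 2 * y)) :
    x * A + y * B < 2 * (x ^ 2 + x * y + y ^ 2) := by
  rcases h with ⟨h1, h2⟩ | ⟨h1, h2⟩ | ⟨h1, h2⟩ | ⟨h1, h2⟩ <;>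
    nlinarith [mul_le_mul_of_nonneg_left h1 hx.le, mul_le_mul_of_nonneg_left h2 hy.le]

/-- The midpoint of an edge of a face of the solid flower lies in the interior of the hexagon with
vertices `α ^ k β`; the coordinates of twice the midpoint are `2 u + 1` and `2 v`. -/
theorem abs_lt_of_in {x y u v : ℤ} (hx : 0 < x) (hy : 0 < y)
    (h : UpIn x y u v ∨ DownIn x y (u + 1) (v - 1)) :
    |x * (2 * u + 1 + 2 * v) + y * (2 * v)| < 2 * (x ^ 2 + x * y + y ^ 2) ∧
    |x * (2 * v) - y * (2 * u + 1)| < 2 * (x ^ 2 + x * y + y ^ 2) ∧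
    |x * (2 * u + 1) + y * (2 * u + 1 + 2 * v)| < 2 * (x ^ 2 + x * y + y ^ 2) := by
  have key : ∀ A B : ℤ, ((A ≤ 2 * x ∧ B ≤ 2 * x + 2 * y - 1) ∨
      (A ≤ 2 * x - 1 ∧ B ≤ 2 * x + 2 * y) ∨ (A ≤ 2 * x + 2 * y ∧ B ≤ 2 * y - 1) ∨
      (A ≤ 2 * x + 2 * y - 1 ∧ B ≤ 2 * y)) → x * A + y * B < 2 * (x ^ 2 + x * y + y ^ 2) :=
    fun A B => half_plane hx hy
  have k1 := key (2 * u + 1 + 2 * v) (2 * v)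
  have k2 := key (-(2 * u + 1 + 2 * v)) (-(2 * v))
  have k3 := key (2 * v) (-(2 * u + 1))
  have k4 := key (-(2 * v)) (2 * u + 1)
  have k5 := key (2 * u + 1) (2 * u + 1 + 2 * v)
  have k6 := key (-(2 * u + 1)) (-(2 * u + 1 + 2 * v))
  clear key
  simp only [abs_lt]
  rcases h with h | h <;> simp only [DownIn, UpIn] at h
  · refine ⟨⟨?_, ?_⟩, ⟨?_, ?_⟩, ?_, ?_⟩
    · linarith [k2 (by omega)]
    · linarith [k1 (by omega)]
    · linarith [k4 (by omega)]
    · linarith [k3 (by omega)]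
    · linarith [k6 (by omega)]
    · linarith [k5 (by omega)]
  · refine ⟨⟨?_, ?_⟩, ⟨?_, ?_⟩, ?_, ?_⟩
    · linarith [k2 (by omega)]
    · linarith [k1 (by omega)]
    · linarith [k4 (by omega)]
    · linarith [k3 (by omega)]
    · linarith [k6 (by omega)]
    · linarith [k5 (by omega)]

/-- A point of the interior of a Voronoi cell of a triangular lattice is closer to the centre than
to any other lattice point. -/
theorem lt_of_voronoi {P Q M w₁ w₂ : ℤ} (hP : |P| < M) (hQ : |Q| < M)
    (hPQ : |P - Q| < M) (hw : w₁ ≠ 0 ∨ w₂ ≠ 0) :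
    w₁ * P + w₂ * Q < M * (w₁ ^ 2 + w₁ * w₂ + w₂ ^ 2) := by
  rw [abs_lt] at hP hQ hPQ
  have hM : 0 < M := by omega
  -- Write `w` as a combination, with coefficients `a, b ≥ 0`, of two neighbouring shortest lattice
  -- vectors, for which the bounds `R, S < M` hold; the norm of `w` is at least `a + b`.
  have bound : ∀ a b c : ℤ, 0 ≤ a → 0 ≤ b → (0 < a ∨ 0 < b) → ∀ R S : ℤ, R < M → S < M →
      c ≥ a + b → a * R + b * S < M * c := by
    intro a b c ha hb hab R S hR hS hc
    have h1 : a * R ≤ a * (M - 1) := mul_le_mul_of_nonneg_left (by omega) ha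
    have h2 : b * S ≤ b * (M - 1) := mul_le_mul_of_nonneg_left (by omega) hb
    have h3 : M * (a + b) ≤ M * c := mul_le_mul_of_nonneg_left hc hM.le
    have : 0 < a + b := by omega
    linarith
  have sq : ∀ a : ℤ, a ≤ a ^ 2 := fun a => by
    rcases le_or_gt a 0 with h | h
    · exact h.trans (sq_nonneg a)
    · nlinarith
  rcases le_total 0 w₁ with h1 | h1 <;> rcases le_total 0 w₂ with h2 | h2
  · refine bound w₁ w₂ _ h1 h2 (by omega) P Q hP.2 hQ.2 ?_
    nlinarith [sq w₁, sq w₂, mul_nonneg h1 h2]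
  · rcases le_total 0 (w₁ + w₂) with h3 | h3
    · have := bound (-w₂) (w₁ + w₂) (w₁ ^ 2 + w₁ * w₂ + w₂ ^ 2) (by omega) h3 (by omega)
        (P - Q) P hPQ.2 hP.2 (by nlinarith [sq (w₁ + w₂), sq (-w₂), mul_nonneg h3 (neg_nonneg.2 h2)])
      linarith
    · have := bound w₁ (-(w₁ + w₂)) (w₁ ^ 2 + w₁ * w₂ + w₂ ^ 2) (by omega) (by omega) (by omega)
        (P - Q) (-Q) hPQ.2 (by omega)
        (by nlinarith [sq (-(w₁ + w₂)), sq w₁, mul_nonneg h1 (neg_nonneg.2 h3)])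
      linarith
  · rcases le_total 0 (w₁ + w₂) with h3 | h3
    · have := bound (-w₁) (w₁ + w₂) (w₁ ^ 2 + w₁ * w₂ + w₂ ^ 2) (by omega) h3 (by omega)
        (Q - P) Q (by omega) hQ.2
        (by nlinarith [sq (w₁ + w₂), sq (-w₁), mul_nonneg h3 (neg_nonneg.2 h1)])
      linarith
    · have := bound w₂ (-(w₁ + w₂)) (w₁ ^ 2 + w₁ * w₂ + w₂ ^ 2) (by omega) (by omega) (by omega)
        (Q - P) (-P) (by omega) (by omega)
        (by nlinarith [sq (-(w₁ + w₂)), sq w₂, mul_nonneg h2 (neg_nonneg.2 h3)])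
      linarith
  · have := bound (-w₁) (-w₂) (w₁ ^ 2 + w₁ * w₂ + w₂ ^ 2) (by omega) (by omega) (by omega)
      (-P) (-Q) (by omega) (by omega)
      (by nlinarith [sq (-w₁), sq (-w₂), mul_nonneg (neg_nonneg.2 h1) (neg_nonneg.2 h2)])
    linarith

/-- An edge and its translate by a non-zero element of `(1 + α) β E` are not both incident to a face
of the solid flower with outer vertex `β`. -/
theorem eq_zero_of_in {β w z : Eisenstein} (hx : 0 < β.re) (hy : 0 < β.im)
    (h : UpIn β.re β.im z.re z.im ∨ DownIn β.re β.im (z.re + 1) (z.im - 1))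
    (h' : UpIn β.re β.im ((1 + alpha) * β * w + z).re ((1 + alpha) * β * w + z).im ∨
      DownIn β.re β.im (((1 + alpha) * β * w + z).re + 1) (((1 + alpha) * β * w + z).im - 1)) :
    w = 0 := by
  by_contra hw
  have hw' : w.re ≠ 0 ∨ w.im ≠ 0 := by
    by_contra! H
    exact hw (QuadraticAlgebra.ext H.1 H.2)
  obtain ⟨h1, h2, h3⟩ := abs_lt_of_in hx hy h
  obtain ⟨h1', h2', h3'⟩ := abs_lt_of_in hx hy h'
  have a1 := lt_of_voronoi (w₁ := -w.re) (w₂ := -w.im) h1 h2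
    (by convert h3 using 2; ring) (by omega)
  have a2 := lt_of_voronoi (w₁ := w.re) (w₂ := w.im) h1' h2'
    (by convert h3' using 2; ring) hw'
  simp [alpha] at a1 a2
  nlinarith

/-! ### The colouring of a flower -/

/-- The set of faces of the solid flower whose outermost layer has the outer vertex `x + y α`, where
`p = (x, y)`. -/
def solid (p : ℤ × ℤ) : Set (Finset Eisenstein) :=
  {t | ∃ z : Eisenstein, (t = up z ∧ UpIn p.1 p.2 z.re z.im) ∨
    (t = down z ∧ DownIn p.1 p.2 z.re z.im)}

theorem up_mem_solid {p : ℤ × ℤ} {z : Eisenstein} :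
    up z ∈ solid p ↔ UpIn p.1 p.2 z.re z.im := by
  constructor
  · rintro ⟨w, ⟨h, hw⟩ | ⟨h, -⟩⟩
    · rwa [up_injective h]
    · exact absurd h (up_ne_down _ _)
  · exact fun h => ⟨z, .inl ⟨rfl, h⟩⟩

theorem down_mem_solid {p : ℤ × ℤ} {z : Eisenstein} :
    down z ∈ solid p ↔ DownIn p.1 p.2 z.re z.im := by
  constructor
  · rintro ⟨w, ⟨h, -⟩ | ⟨h, hw⟩⟩
    · exact absurd h.symm (up_ne_down _ _)
    · rwa [down_injective h]
  · exact fun h => ⟨z, .inr ⟨rfl, h⟩⟩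

theorem Admissible.nonneg {p : ℤ × ℤ} (hp : Admissible p) : 0 ≤ p.1 ∧ 0 < p.2 := by
  rcases hp with ⟨h1, h2, -⟩ | rfl
  · exact ⟨h1.le, h2⟩
  · simp

theorem solid_euclid_subset {p : ℤ × ℤ} (hp : Admissible p) : solid (euclid p) ⊆ solid p := by
  obtain ⟨h1, h2⟩ := hp.nonneg
  rintro t ⟨z, ⟨rfl, h⟩ | ⟨rfl, h⟩⟩
  · exact up_mem_solid.2 (UpIn.of_euclid h1 h2.le h)
  · exact down_mem_solid.2 (UpIn.of_euclid h1 h2.le h)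

theorem mem_necklace_iff {p : ℤ × ℤ} (hp : Admissible p) (hx : 0 < p.1) {t : Finset Eisenstein}
    (ht : t ∈ faces) : t ∈ necklace p.1 p.2 ↔ t ∈ solid p ∧ t ∉ solid (euclid p) := by
  obtain ⟨z, rfl | rfl⟩ := eq_up_or_eq_down ht
  · rw [up_mem_solid, up_mem_solid]
    exact up_mem_necklace hp hx
  · rw [down_mem_solid, down_mem_solid]
    exact down_mem_necklace hp hx

/-- The pair `(0, 1)`, at which the algorithm comes to rest, describes the hexagon formed by the six
faces around the centre. -/
theorem center_mem_solid (k : ℕ) : {0, alpha ^ k, alpha ^ (k + 1)} ∈ solid (0, 1) := by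
  rw [pow_succ]
  rcases alpha_pow_cases k with ⟨-, h⟩ | ⟨-, h⟩ | ⟨-, h⟩ | ⟨-, h⟩ | ⟨-, h⟩ | ⟨-, h⟩ <;> rw [h]
  · exact ⟨0, .inl ⟨by decide, by simp [UpIn]⟩⟩
  · exact ⟨0, .inr ⟨by decide, by simp [DownIn, UpIn]⟩⟩
  · exact ⟨⟨-1, 0⟩, .inl ⟨by decide, by simp [UpIn]⟩⟩
  · exact ⟨⟨0, -1⟩, .inr ⟨by decide, by simp [DownIn, UpIn]⟩⟩
  · exact ⟨⟨0, -1⟩, .inl ⟨by decide, by simp [UpIn]⟩⟩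
  · exact ⟨⟨1, -1⟩, .inr ⟨by decide, by simp [DownIn, UpIn]⟩⟩

/-- The outer vertex of the `k`-th layer of the flower with outer vertex `p`. -/
def layer (p : ℤ × ℤ) (k : ℕ) : ℤ × ℤ := euclid^[k] p

theorem layer_succ (p : ℤ × ℤ) (k : ℕ) : layer p (k + 1) = euclid (layer p k) :=
  Function.iterate_succ_apply' _ _ _

theorem layer_admissible {p : ℤ × ℤ} (hp : Admissible p) (k : ℕ) : Admissible (layer p k) := by
  induction k with
  | zero => exact hp
  | succ k ih => rw [layer_succ]; exact ih.euclid

theorem layer_pos_of_succ {p : ℤ × ℤ} (hp : Admissible p) {k : ℕ} (h : 0 < (layer p (k + 1)).1) :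
    0 < (layer p k).1 := by
  rw [layer_succ] at h
  rcases layer_admissible hp k with ⟨h1, -, -⟩ | h0
  · exact h1
  · rw [h0] at h
    exact absurd h (by decide)

theorem layer_pos_of_le {p : ℤ × ℤ} (hp : Admissible p) {j k : ℕ} (hjk : j ≤ k)
    (h : 0 < (layer p k).1) : 0 < (layer p j).1 := by
  induction k, hjk using Nat.le_induction with
  | base => exact h
  | succ k _ ih => exact ih (layer_pos_of_succ hp h)

theorem layer_eq_of_not_pos {p : ℤ × ℤ} (hp : Admissible p) {k : ℕ} (h : ¬ 0 < (layer p k).1) :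
    layer p k = (0, 1) := by
  rcases layer_admissible hp k with ⟨h1, -, -⟩ | h0
  · exact absurd h1 h
  · exact h0

theorem layer_sum_add_le {p : ℤ × ℤ} (hp : Admissible p) {k : ℕ} (h : 0 < (layer p k).1) :
    (layer p k).1 + (layer p k).2 + k ≤ p.1 + p.2 := by
  induction k with
  | zero => simp [layer]
  | succ k ih =>
    have h0 := layer_pos_of_succ hp h
    have := ih h0
    have h2 := (layer_admissible hp k).nonneg.2
    rw [layer_succ, euclid]
    split_ifs <;> push_cast <;> linarith

theorem layer_lt {p : ℤ × ℤ} (hp : Admissible p) {k : ℕ} (h : 0 < (layer p k).1) :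
    k < (p.1 + p.2).toNat := by
  have := layer_sum_add_le hp h
  have := (layer_admissible hp k).nonneg.2
  omega

theorem isLayer_iff {a b : ℤ} (hp : Admissible (a, b)) (ha : 0 < a) {k : ℕ} {x y : ℤ} :
    IsLayer a b k x y ↔ layer (a, b) k = (x, y) ∧ 0 < x := by
  constructor
  · intro h
    suffices layer (a, b) k = (x, y) ∧ 0 < x ∧ 0 < y from ⟨this.1, this.2.1⟩
    induction h with
    | outer => exact ⟨rfl, ha, hp.nonneg.2⟩
    | @left k x y _ hxy ih =>
      rw [layer_succ, ih.1, euclid]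
      simpa [hxy] using ih.2.1
    | @right k x y _ hxy ih =>
      rw [layer_succ, ih.1, euclid]
      simpa [hxy, hxy.le] using ih.2.2
  · rintro ⟨h, hx⟩
    induction k generalizing x y with
    | zero =>
      obtain ⟨rfl, rfl⟩ := Prod.ext_iff.1 h
      exact .outer
    | succ k ih =>
      have h0 : 0 < (layer (a, b) (k + 1)).1 := by rw [h]; exact hx
      have h1 := layer_pos_of_succ hp h0
      have ih := ih (x := (layer (a, b) k).1) (y := (layer (a, b) k).2) rfl h1
      rw [layer_succ, euclid] at h
      split_ifs at h with hlt <;> obtain ⟨rfl, rfl⟩ := Prod.ext_iff.1 h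
      · exact ih.left hlt
      · exact ih.right (by simpa using hx)

theorem solid_layer_antitone {p : ℤ × ℤ} (hp : Admissible p) :
    Antitone fun k => solid (layer p k) := by
  refine antitone_nat_of_succ_le fun k => ?_
  rw [layer_succ]
  exact solid_euclid_subset (layer_admissible hp k)

theorem solid_center_subset {p : ℤ × ℤ} (hp : Admissible p) (k : ℕ) :
    solid (0, 1) ⊆ solid (layer p k) := by
  by_cases h : 0 < (layer p (max k (p.1 + p.2).toNat)).1
  · exact absurd (layer_lt hp h) (by omega)
  · rw [← layer_eq_of_not_pos hp h]
    exact solid_layer_antitone hp (le_max_left _ _)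

theorem mem_flowerBlack_iff {β : Eisenstein} (hp : Admissible (β.re, β.im)) (hx : 0 < β.re)
    {t : Finset Eisenstein} (ht : t ∈ faces) : t ∈ flowerBlack β ↔
      (∃ k, Even k ∧ 0 < (layer (β.re, β.im) k).1 ∧ t ∈ solid (layer (β.re, β.im) k) ∧
        t ∉ solid (layer (β.re, β.im) (k + 1))) ∨
      ∃ k : ℕ, Even k ∧ t = {0, alpha ^ k, alpha ^ (k + 1)} := by
  refine or_congr ⟨?_, ?_⟩ Iff.rfl
  · rintro ⟨k, x, y, hk, hl, h⟩
    obtain ⟨hl, hx'⟩ := (isLayer_iff hp hx).1 hl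
    have := (mem_necklace_iff (p := (x, y)) (hl ▸ layer_admissible hp k) hx' ht).1 h
    exact ⟨k, hk, by rwa [hl], by rw [hl]; exact this.1, by rw [layer_succ, hl]; exact this.2⟩
  · rintro ⟨k, hk, h0, h1, h2⟩
    rw [layer_succ] at h2
    exact ⟨k, _, _, hk, (isLayer_iff hp hx).2 ⟨rfl, h0⟩,
      (mem_necklace_iff (layer_admissible hp k) h0 ht).2 ⟨h1, h2⟩⟩

/-- The colour of a face in the `k`-th layer. -/
theorem mem_flowerBlack_iff_even {β : Eisenstein} (hp : Admissible (β.re, β.im)) (hx : 0 < β.re)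
    {t : Finset Eisenstein} (ht : t ∈ faces) {k : ℕ} (h0 : 0 < (layer (β.re, β.im) k).1)
    (h1 : t ∈ solid (layer (β.re, β.im) k)) (h2 : t ∉ solid (layer (β.re, β.im) (k + 1))) :
    t ∈ flowerBlack β ↔ Even k := by
  rw [mem_flowerBlack_iff hp hx ht]
  constructor
  · rintro (⟨j, hj, -, hj1, hj2⟩ | ⟨j, -, rfl⟩)
    · rcases lt_trichotomy j k with h | rfl | h
      · exact absurd (solid_layer_antitone hp (Nat.succ_le_of_lt h) h1) hj2
      · exact hj
      · exact absurd (solid_layer_antitone hp (Nat.succ_le_of_lt h) hj1) h2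
    · exact absurd (solid_center_subset hp _ (center_mem_solid j)) h2
  · exact fun hk => .inl ⟨k, hk, h0, h1, h2⟩

theorem flowerBlack_subset_solid {β : Eisenstein} (hp : Admissible (β.re, β.im))
    (hx : 0 < β.re) : flowerBlack β ⊆ solid (β.re, β.im) := by
  intro t h
  rcases (mem_flowerBlack_iff hp hx (flowerBlack_subset_faces β h)).1 h with
    ⟨k, -, -, h1, -⟩ | ⟨j, -, rfl⟩
  · exact solid_layer_antitone hp (Nat.zero_le k) h1
  · exact solid_center_subset hp 0 (center_mem_solid j)

/-- The horizontal edge with left endpoint `z` separates faces of different colours in the colouring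
of the flower centred at `0`, all faces outside this flower being white. -/
def FlowerFold (β z : Eisenstein) : Prop :=
  ¬ (up z ∈ flowerBlack β ↔ down (z + ⟨1, -1⟩) ∈ flowerBlack β)

theorem onBoundary_layer_iff {p : ℤ × ℤ} (hp : Admissible p) (k : ℕ) {z : Eisenstein} :
    OnBoundary (layer p k).1 (layer p k).2 z.re z.im ↔
      ¬ (up z ∈ solid (layer p k) ↔ down (z + ⟨1, -1⟩) ∈ solid (layer p k)) := by
  obtain ⟨h1, h2⟩ := (layer_admissible hp k).nonneg
  rw [onBoundary_iff h1 h2, up_mem_solid, down_mem_solid]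
  simp [sub_eq_add_neg]

theorem OnBoundary.mem_solid {p : ℤ × ℤ} (hp : Admissible p) {k : ℕ} (h0 : 0 < (layer p k).1)
    {z : Eisenstein} (h : OnBoundary (layer p (k + 1)).1 (layer p (k + 1)).2 z.re z.im) :
    up z ∈ solid (layer p k) ∧ down (z + ⟨1, -1⟩) ∈ solid (layer p k) := by
  rw [layer_succ] at h
  have := OnBoundary.of_euclid h0 (layer_admissible hp k).nonneg.2 h
  rw [up_mem_solid, down_mem_solid]
  simpa [sub_eq_add_neg] using this

theorem OnBoundary.flowerFold {β z : Eisenstein} (hp : Admissible (β.re, β.im)) (hx : 0 < β.re)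
    {k : ℕ} (h0 : 0 < (layer (β.re, β.im) k).1)
    (h : OnBoundary (layer (β.re, β.im) k).1 (layer (β.re, β.im) k).2 z.re z.im) :
    FlowerFold β z := by
  have key : ∀ s ∈ faces, ∀ t ∈ faces, s ∈ solid (layer (β.re, β.im) k) →
      t ∉ solid (layer (β.re, β.im) k) → s ∉ solid (layer (β.re, β.im) (k + 1)) →
      (∀ j, k = j + 1 → t ∈ solid (layer (β.re, β.im) j)) →
      ¬ (s ∈ flowerBlack β ↔ t ∈ flowerBlack β) := by
    intro s hs t ht h1 h2 h3 h4
    rw [mem_flowerBlack_iff_even hp hx hs h0 h1 h3]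
    rcases k with _ | j
    · have : t ∉ flowerBlack β := fun h => h2 (flowerBlack_subset_solid hp hx h)
      simp [this]
    · rw [mem_flowerBlack_iff_even hp hx ht (layer_pos_of_succ hp h0) (h4 j rfl) h2,
        Nat.even_add_one]
      tauto
  have hin : ∀ j, k = j + 1 → up z ∈ solid (layer (β.re, β.im) j) ∧
      down (z + ⟨1, -1⟩) ∈ solid (layer (β.re, β.im) j) := by
    rintro j rfl
    exact h.mem_solid hp (layer_pos_of_succ hp h0)
  have hb := (onBoundary_layer_iff hp k).1 h
  have hnext := fun h => (onBoundary_layer_iff hp (k + 1) (z := z)).2 h |>.mem_solid hp h0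
  have hanti := solid_layer_antitone hp (Nat.le_add_right k 1)
  by_cases hu : up z ∈ solid (layer (β.re, β.im) k)
  · have hd : down (z + ⟨1, -1⟩) ∉ solid (layer (β.re, β.im) k) := by tauto
    refine key _ (up_mem_faces z) _ (down_mem_faces _) hu hd (fun hu' => hd (hnext ?_).2)
      fun j hj => (hin j hj).2
    have : down (z + ⟨1, -1⟩) ∉ solid (layer (β.re, β.im) (k + 1)) := fun h => hd (hanti h)
    tauto
  · have hd : down (z + ⟨1, -1⟩) ∈ solid (layer (β.re, β.im) k) := by tauto
    have := key _ (down_mem_faces (z + ⟨1, -1⟩)) _ (up_mem_faces z) hd hu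
      (fun hd' => hu (hnext ?_).1) fun j hj => (hin j hj).1
    · rw [FlowerFold]
      tauto
    · have : up z ∉ solid (layer (β.re, β.im) (k + 1)) := fun h => hu (hanti h)
      tauto

/-- Up to four edges at the centre, the interfaces of a flower are the boundaries of its layers. -/
theorem FlowerFold.onBoundary {β z : Eisenstein} (hp : Admissible (β.re, β.im)) (hx : 0 < β.re)
    (h : FlowerFold β z) :
    (∃ k, 0 < (layer (β.re, β.im) k).1 ∧
      OnBoundary (layer (β.re, β.im) k).1 (layer (β.re, β.im) k).2 z.re z.im) ∨
    z ∈ ({⟨0, 0⟩, ⟨-1, 0⟩, ⟨-1, 1⟩, ⟨0, -1⟩} : Finset Eisenstein) := by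
  by_contra! H
  obtain ⟨H1, H2⟩ := H
  have hz : ¬ OnBoundary 0 1 z.re z.im ∧ up z ∉ solid (0, 1) := by
    rw [up_mem_solid]
    simp only [Finset.mem_insert, Finset.mem_singleton, QuadraticAlgebra.ext_iff] at H2
    simp only [OnBoundary, UpIn]
    constructor <;> omega
  have hz' : down (z + ⟨1, -1⟩) ∉ solid (0, 1) := by
    have := hz.1
    rw [onBoundary_iff le_rfl one_pos, not_not] at this
    rw [down_mem_solid]
    rw [up_mem_solid, this] at hz
    simpa [sub_eq_add_neg] using hz.2
  have key : ∀ k, (up z ∈ solid (layer (β.re, β.im) k) ↔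
      down (z + ⟨1, -1⟩) ∈ solid (layer (β.re, β.im) k)) := by
    intro k
    by_contra hk
    rw [← onBoundary_layer_iff hp k] at hk
    by_cases h0 : 0 < (layer (β.re, β.im) k).1
    · exact H1 k h0 hk
    · rw [layer_eq_of_not_pos hp h0] at hk
      exact hz.1 hk
  refine h ?_
  rw [mem_flowerBlack_iff hp hx (up_mem_faces z), mem_flowerBlack_iff hp hx (down_mem_faces _)]
  refine or_congr ?_ ?_
  · simp only [key]
  · refine iff_of_false ?_ ?_
    · rintro ⟨k, -, hk⟩
      exact hz.2 (hk ▸ center_mem_solid k)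
    · rintro ⟨k, -, hk⟩
      exact hz' (hk ▸ center_mem_solid k)

/-! ### The fold count -/

theorem vadd_mem_blackFaces {β w : Eisenstein} {t : Finset Eisenstein} (ht : t ∈ blackFaces β) :
    ((1 + alpha) * β * w) +ᵥ t ∈ blackFaces β := by
  obtain ⟨v, s, hs, rfl⟩ := ht
  exact ⟨w + v, s, hs, by rw [vadd_vadd, mul_add]⟩

theorem vadd_mem_blackFaces_iff {β w : Eisenstein} {t : Finset Eisenstein} :
    ((1 + alpha) * β * w) +ᵥ t ∈ blackFaces β ↔ t ∈ blackFaces β := by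
  refine ⟨fun h => ?_, vadd_mem_blackFaces⟩
  have := vadd_mem_blackFaces (w := -w) h
  rwa [vadd_vadd, mul_neg, neg_add_cancel, zero_vadd] at this

/-- One of the two faces at the horizontal edge with left endpoint `z` lies in the flower centred
at `0`. -/
def Incident (β z : Eisenstein) : Prop :=
  UpIn β.re β.im z.re z.im ∨ DownIn β.re β.im (z.re + 1) (z.im - 1)

theorem incident_iff {β z : Eisenstein} : Incident β z ↔
    up z ∈ solid (β.re, β.im) ∨ down (z + ⟨1, -1⟩) ∈ solid (β.re, β.im) := by
  rw [up_mem_solid, down_mem_solid]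
  simp [Incident, sub_eq_add_neg]

theorem exists_of_mem_blackFaces {β : Eisenstein} (hp : Admissible (β.re, β.im)) (hx : 0 < β.re)
    {t : Finset Eisenstein} (ht : t ∈ blackFaces β) :
    ∃ w, ((1 + alpha) * β * w) +ᵥ t ∈ flowerBlack β ∧
      ((1 + alpha) * β * w) +ᵥ t ∈ solid (β.re, β.im) := by
  obtain ⟨w, s, hs, rfl⟩ := ht
  refine ⟨-w, ?_⟩
  rw [vadd_vadd, mul_neg, neg_add_cancel, zero_vadd]
  exact ⟨hs, flowerBlack_subset_solid hp hx hs⟩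

theorem flowerBlack_subset_blackFaces (β : Eisenstein) : flowerBlack β ⊆ blackFaces β :=
  fun t ht => ⟨0, t, ht, by simp⟩

theorem vadd_lower (w z : Eisenstein) :
    w +ᵥ down (z + ⟨1, -1⟩) = down (w + z + ⟨1, -1⟩) := by
  rw [vadd_down, add_assoc]

theorem Incident.mem_blackFaces_iff {β z : Eisenstein} (hp : Admissible (β.re, β.im))
    (hx : 0 < β.re) (h : Incident β z) :
    (up z ∈ blackFaces β ↔ up z ∈ flowerBlack β) ∧
      (down (z + ⟨1, -1⟩) ∈ blackFaces β ↔ down (z + ⟨1, -1⟩) ∈ flowerBlack β) := by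
  constructor <;> refine ⟨fun hb => ?_, fun hb => flowerBlack_subset_blackFaces β hb⟩ <;>
    obtain ⟨w, hw, hw'⟩ := exists_of_mem_blackFaces hp hx hb
  · have : w = 0 := by
      refine eq_zero_of_in hx hp.nonneg.2 h (incident_iff.2 (.inl ?_))
      rwa [← vadd_up]
    simpa [this] using hw
  · have : w = 0 := by
      refine eq_zero_of_in hx hp.nonneg.2 h (incident_iff.2 (.inr ?_))
      rwa [← vadd_lower]
    simpa [this] using hw

theorem FlowerFold.incident {β z : Eisenstein} (hp : Admissible (β.re, β.im)) (hx : 0 < β.re)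
    (h : FlowerFold β z) : Incident β z := by
  have h1 := @flowerBlack_subset_solid _ hp hx (up z)
  have h2 := @flowerBlack_subset_solid _ hp hx (down (z + ⟨1, -1⟩))
  rw [incident_iff]
  rw [FlowerFold] at h
  tauto

/-- Every edge which forms an interface in the plane is equivalent under `G_β` to exactly one
horizontal edge which forms an interface of the flower centred at `0`. -/
theorem foldCount_eq {β : Eisenstein} (hp : Admissible (β.re, β.im)) (hx : 0 < β.re) :
    foldCount β = {z | FlowerFold β z}.ncard := by
  have himage : toQuotient β '' foldEdges β =
      (fun z => toQuotient β (horizontal z)) '' {z | FlowerFold β z} := by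
    ext q
    constructor
    · rintro ⟨e, he, rfl⟩
      obtain ⟨i, z, hz⟩ := exists_image_eq_horizontal he.1
      have hfold := image_pow_mem_foldEdges he i
      rw [hz, horizontal_mem_foldEdges_iff] at hfold
      obtain ⟨w, hw⟩ : ∃ w, Incident β ((1 + alpha) * β * w + z) := by
        by_cases hu : up z ∈ blackFaces β
        · obtain ⟨w, -, hw⟩ := exists_of_mem_blackFaces hp hx hu
          exact ⟨w, incident_iff.2 (.inl (by rwa [← vadd_up]))⟩
        · obtain ⟨w, -, hw⟩ := exists_of_mem_blackFaces hp hx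
            (show down (z + ⟨1, -1⟩) ∈ blackFaces β by tauto)
          exact ⟨w, incident_iff.2 (.inr (by rwa [← vadd_lower]))⟩
      refine ⟨(1 + alpha) * β * w + z, ?_, ?_⟩
      · rw [Set.mem_ofPred_eq, FlowerFold]
        obtain ⟨h1, h2⟩ := hw.mem_blackFaces_iff hp hx
        rwa [← h1, ← h2, ← vadd_up, ← vadd_lower, vadd_mem_blackFaces_iff, vadd_mem_blackFaces_iff]
      · refine toQuotient_eq_iff.2 ⟨i, w, ?_⟩
        rw [hz, vadd_horizontal]
    · rintro ⟨z, hz, rfl⟩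
      refine ⟨_, ?_, rfl⟩
      rw [horizontal_mem_foldEdges_iff]
      obtain ⟨h1, h2⟩ := (FlowerFold.incident hp hx hz).mem_blackFaces_iff hp hx
      rwa [h1, h2]
  rw [foldCount, himage, Set.InjOn.ncard_image]
  intro z hz z' hz' h
  obtain ⟨u, rfl⟩ := toQuotient_horizontal_eq h
  have : u = 0 := eq_zero_of_in hx hp.nonneg.2 (FlowerFold.incident hp hx hz')
    (FlowerFold.incident hp hx hz)
  simp [this]

/-- The left endpoints of the horizontal edges on the boundary of a solid flower. -/
noncomputable def boundary (p : ℤ × ℤ) : Finset Eisenstein :=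
  ((Finset.Ico (p.1 - p.2) p.1).image (⟨·, p.2⟩) ∪
    (Finset.Ico (-p.1) (p.2 - p.1)).image (⟨·, -p.2⟩)) ∪
  ((Finset.Ico p.2 (p.1 + p.2)).image (⟨·, -p.1⟩) ∪
    (Finset.Ico (-(p.1 + p.2)) (-p.2)).image (⟨·, p.1⟩))

theorem mem_boundary {p : ℤ × ℤ} {z : Eisenstein} :
    z ∈ boundary p ↔ OnBoundary p.1 p.2 z.re z.im := by
  simp only [boundary, Finset.mem_union, Finset.mem_image, Finset.mem_Ico, OnBoundary,
    QuadraticAlgebra.ext_iff]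
  constructor
  · rintro ((⟨i, h⟩ | ⟨i, h⟩) | ⟨i, h⟩ | ⟨i, h⟩) <;> omega
  · rintro (h | h | h | h)
    · exact .inl (.inl ⟨z.re, by omega⟩)
    · exact .inl (.inr ⟨z.re, by omega⟩)
    · exact .inr (.inl ⟨z.re, by omega⟩)
    · exact .inr (.inr ⟨z.re, by omega⟩)

theorem card_boundary {p : ℤ × ℤ} (h1 : 0 < p.1) (h2 : 0 < p.2) :
    ((boundary p).card : ℤ) = 2 * (p.1 + p.2) := by
  have hinj : ∀ c : ℤ, Function.Injective (fun i : ℤ => (⟨i, c⟩ : Eisenstein)) :=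
    fun c i j h => congrArg QuadraticAlgebra.re h
  have d1 : Disjoint ((Finset.Ico (p.1 - p.2) p.1).image (fun i => (⟨i, p.2⟩ : Eisenstein)))
      ((Finset.Ico (-p.1) (p.2 - p.1)).image (⟨·, -p.2⟩)) := by
    rw [Finset.disjoint_left]
    intro z
    simp only [Finset.mem_image, Finset.mem_Ico, QuadraticAlgebra.ext_iff]
    rintro ⟨i, hi⟩ ⟨j, hj⟩
    omega
  have d2 : Disjoint ((Finset.Ico p.2 (p.1 + p.2)).image (fun i => (⟨i, -p.1⟩ : Eisenstein)))
      ((Finset.Ico (-(p.1 + p.2)) (-p.2)).image (⟨·, p.1⟩)) := by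
    rw [Finset.disjoint_left]
    intro z
    simp only [Finset.mem_image, Finset.mem_Ico, QuadraticAlgebra.ext_iff]
    rintro ⟨i, hi⟩ ⟨j, hj⟩
    omega
  rw [boundary, Finset.card_union_of_disjoint, Finset.card_union_of_disjoint d1,
    Finset.card_union_of_disjoint d2, Finset.card_image_of_injective _ (hinj _),
    Finset.card_image_of_injective _ (hinj _), Finset.card_image_of_injective _ (hinj _),
    Finset.card_image_of_injective _ (hinj _)]
  · simp only [Int.card_Ico]
    omega
  · rw [Finset.disjoint_left]
    intro z
    simp only [Finset.mem_union, Finset.mem_image, Finset.mem_Ico, QuadraticAlgebra.ext_iff]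
    rintro (⟨i, hi⟩ | ⟨i, hi⟩) (⟨j, hj⟩ | ⟨j, hj⟩) <;> omega

/-- The contribution `x + y` of a pair to the length of the layer boundaries; it is zero once the
subtractive Euclidean algorithm has terminated. -/
def weight {R : Type*} [Zero R] [Add R] [LT R] [DecidableLT R] (p : R × R) : R :=
  if 0 < p.1 then p.1 + p.2 else 0

theorem boundary_layer_disjoint {p : ℤ × ℤ} (hp : Admissible p) {j k : ℕ} (hjk : j < k)
    (h0 : 0 < (layer p k).1) : Disjoint (boundary (layer p j)) (boundary (layer p k)) := by
  rw [Finset.disjoint_left]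
  intro z hj hk
  obtain ⟨k, rfl⟩ := Nat.exists_eq_add_of_lt hjk
  rw [mem_boundary] at hj hk
  have := hk.mem_solid hp (layer_pos_of_succ hp h0)
  have hle : j ≤ j + k := Nat.le_add_right _ _
  exact (onBoundary_layer_iff hp j).1 hj
    (iff_of_true (solid_layer_antitone hp hle this.1) (solid_layer_antitone hp hle this.2))

/-- The fold count is twice the sum of `x + y` over the outer vertices `x + y α` of all layers, up
to the contribution of the six faces at the centre. -/
theorem foldCount_bounds {β : Eisenstein} (hp : Admissible (β.re, β.im)) (hx : 0 < β.re) :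
    2 * ∑ k ∈ Finset.range (β.re + β.im).toNat, weight (layer (β.re, β.im) k) ≤ foldCount β ∧
    (foldCount β : ℤ) ≤
      2 * ∑ k ∈ Finset.range (β.re + β.im).toNat, weight (layer (β.re, β.im) k) + 4 := by
  set I := (Finset.range (β.re + β.im).toNat).filter fun k => 0 < (layer (β.re, β.im) k).1 with hI
  set U := I.biUnion fun k => boundary (layer (β.re, β.im) k) with hU
  have hcard : (U.card : ℤ) =
      2 * ∑ k ∈ Finset.range (β.re + β.im).toNat, weight (layer (β.re, β.im) k) := by
    rw [hU, Finset.card_biUnion]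
    · simp only [weight]
      rw [← Finset.sum_filter, Finset.mul_sum, Nat.cast_sum]
      refine Finset.sum_congr rfl fun k hk => ?_
      exact card_boundary (Finset.mem_filter.1 hk).2 (layer_admissible hp k).nonneg.2
    · intro j hj k hk hjk
      rcases lt_or_gt_of_ne hjk with h | h
      · exact boundary_layer_disjoint hp h (Finset.mem_filter.1 hk).2
      · exact (boundary_layer_disjoint hp h (Finset.mem_filter.1 hj).2).symm
  set C : Finset Eisenstein := {⟨0, 0⟩, ⟨-1, 0⟩, ⟨-1, 1⟩, ⟨0, -1⟩} with hC
  have hCcard : C.card = 4 := by decide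
  have h1 : (U : Set Eisenstein) ⊆ {z | FlowerFold β z} := by
    intro z hz
    simp only [hU, Finset.coe_biUnion, Set.mem_iUnion, Finset.mem_coe, mem_boundary] at hz
    obtain ⟨k, hk, hz⟩ := hz
    exact hz.flowerFold hp hx (Finset.mem_filter.1 hk).2
  have h2 : {z | FlowerFold β z} ⊆ ((U ∪ C : Finset Eisenstein) : Set Eisenstein) := by
    intro z hz
    rw [Finset.mem_coe, Finset.mem_union]
    refine (FlowerFold.onBoundary hp hx hz).imp_left ?_
    rintro ⟨k, hk, hz⟩
    exact Finset.mem_biUnion.2 ⟨k, Finset.mem_filter.2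
      ⟨Finset.mem_range.2 (layer_lt hp hk), hk⟩, mem_boundary.2 hz⟩
  rw [foldCount_eq hp hx, ← hcard]
  have e1 := Set.ncard_le_ncard h1 ((Finset.finite_toSet _).subset h2)
  have e2 := Set.ncard_le_ncard h2 (Finset.finite_toSet _)
  rw [Set.ncard_coe_finset] at e1 e2
  have e3 := Finset.card_union_le U C
  exact ⟨by exact_mod_cast e1, by exact_mod_cast (by omega)⟩

/-! ### The number of faces -/

/-- The lattice of the translations in `G_β`. -/
def translationLattice (β : Eisenstein) : Submodule ℤ Eisenstein :=
  LinearMap.range (DistribSMul.toLinearMap ℤ Eisenstein ((1 + alpha) * β))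

theorem mem_translationLattice {β z : Eisenstein} :
    z ∈ translationLattice β ↔ ∃ u, (1 + alpha) * β * u = z := Iff.rfl

theorem card_quotient_translationLattice {β : Eisenstein} (hx : 0 < β.re) (hy : 0 < β.im) :
    (Nat.card (Eisenstein ⧸ translationLattice β) : ℤ) =
      3 * (β.re ^ 2 + β.re * β.im + β.im ^ 2) := by
  set γ := (1 + alpha) * β with hγ
  have hre : γ.re = β.re - β.im := by simp [hγ, alpha]; ring
  have him : γ.im = β.re + 2 * β.im := by simp [hγ, alpha]; ring
  have hN : γ.re ^ 2 + γ.re * γ.im + γ.im ^ 2 =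
      3 * (β.re ^ 2 + β.re * β.im + β.im ^ 2) := by rw [hre, him]; ring
  have hpos : 0 < γ.re ^ 2 + γ.re * γ.im + γ.im ^ 2 := by rw [hN]; positivity
  have hinj : Function.Injective (DistribSMul.toLinearMap ℤ Eisenstein γ) := by
    rw [injective_iff_map_eq_zero]
    intro z hz
    have hz' : γ * z = 0 := hz
    have h1 := congrArg QuadraticAlgebra.re hz'
    have h2 := congrArg QuadraticAlgebra.im hz'
    simp only [QuadraticAlgebra.re_mul, QuadraticAlgebra.im_mul, QuadraticAlgebra.re_zero,
      QuadraticAlgebra.im_zero] at h1 h2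
    ext
    · have : (γ.re ^ 2 + γ.re * γ.im + γ.im ^ 2) * z.re = 0 := by
        linear_combination (γ.re + γ.im) * h1 + γ.im * h2
      simpa [hpos.ne'] using this
    · have : (γ.re ^ 2 + γ.re * γ.im + γ.im ^ 2) * z.im = 0 := by
        linear_combination γ.re * h2 - γ.im * h1
      simpa [hpos.ne'] using this
  have h := Submodule.natAbs_det_equiv (translationLattice β) (LinearEquiv.ofInjective _ hinj)
  rw [← h, ← hN]
  have hcomp : (translationLattice β).subtype ∘ₗ
      AddMonoidHom.toIntLinearMap (LinearEquiv.ofInjective _ hinj : Eisenstein →+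
        LinearMap.range (DistribSMul.toLinearMap ℤ Eisenstein γ)) =
      DistribSMul.toLinearMap ℤ Eisenstein γ := by
    ext <;> rfl
  erw [hcomp]
  rw [QuadraticAlgebra.det_toLinearMap_eq_norm, Int.natCast_natAbs]
  have : QuadraticAlgebra.norm γ = γ.re ^ 2 + γ.re * γ.im + γ.im ^ 2 := by
    simp [QuadraticAlgebra.norm]; ring
  rw [this, abs_of_pos hpos]

/-- A family of faces permuted by the rotation of order three about `0` and by the translations:
each orbit under `G_β` meets it in three classes modulo translations. -/
theorem three_mul_ncard_toQuotient {β c : Eisenstein} (hx : 0 < β.re) (hy : 0 < β.im)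
    {face : Eisenstein → Finset Eisenstein} (hinj : Function.Injective face)
    (hrot : ∀ z, (face z).image (alpha ^ 2 * ·) = face (alpha ^ 2 * z + c))
    (htrans : ∀ w z, w +ᵥ face z = face (w + z)) (hc : ¬ (3 : ℤ) ∣ c.re - c.im) :
    3 * (toQuotient β '' Set.range face).ncard = Nat.card (Eisenstein ⧸ translationLattice β) := by
  set I := translationLattice β with hI
  have hcard := card_quotient_translationLattice hx hy
  have hfin : Finite (Eisenstein ⧸ I) := by
    refine Nat.finite_of_card_ne_zero fun h => ?_
    rw [← hI, h] at hcard
    have : 0 < 3 * (β.re ^ 2 + β.re * β.im + β.im ^ 2) := by positivity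
    omega
  have := Fintype.ofFinite (Eisenstein ⧸ I)
  classical
  set ρ : Eisenstein → Eisenstein := fun z => alpha ^ 2 * z + c with hρ
  have hpow : ∀ i z, (face z).image (alpha ^ (2 * i) * ·) = face (ρ^[i] z) := by
    intro i z
    induction i with
    | zero => simp
    | succ i ih =>
      rw [Function.iterate_succ_apply', ← hrot, ← ih, image_image_mul, ← pow_add]
      congr! 3
      ring
  have hρ3 : ∀ z, ρ^[3] z = z := by
    intro z
    apply hinj
    rw [← hpow, image_mul_eq_self (by decide)]
  have hmk : ∀ z z' : Eisenstein, I.mkQ z = I.mkQ z' ↔ ∃ u, z = (1 + alpha) * β * u + z' := by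
    intro z z'
    simp only [Submodule.mkQ_apply]
    rw [Submodule.Quotient.eq, mem_translationLattice]
    exact exists_congr fun u => by rw [eq_comm, sub_eq_iff_eq_add]
  have hiff : ∀ z z' : Eisenstein, toQuotient β (face z) = toQuotient β (face z') ↔
      I.mkQ z = I.mkQ z' ∨ I.mkQ z = I.mkQ (ρ z') ∨ I.mkQ z = I.mkQ (ρ (ρ z')) := by
    intro z z'
    rw [toQuotient_eq_iff]
    simp only [hpow, htrans, hinj.eq_iff, hmk]
    constructor
    · rintro ⟨i, u, h⟩
      have h3 : ρ^[i] z' = ρ^[i % 3] z' := by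
        conv_lhs => rw [← Nat.mod_add_div i 3, Function.iterate_add_apply, Function.iterate_mul]
        congr 1
        exact Function.iterate_fixed (hρ3 z') _
      rw [h3] at h
      have hlt : i % 3 < 3 := Nat.mod_lt _ (by norm_num)
      interval_cases i % 3
      · exact .inl ⟨u, h⟩
      · exact .inr (.inl ⟨u, h⟩)
      · exact .inr (.inr ⟨u, h⟩)
    · rintro (⟨u, h⟩ | ⟨u, h⟩ | ⟨u, h⟩)
      · exact ⟨0, u, h⟩
      · exact ⟨1, u, h⟩
      · exact ⟨2, u, h⟩
  -- Modulo the prime `1 + α` above `3`, the rotation is the translation by `c ≠ 0`.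
  have hmod : ∀ z z' : Eisenstein, I.mkQ z = I.mkQ z' → (3 : ℤ) ∣ (z.re - z.im) - (z'.re - z'.im) := by
    intro z z' h
    obtain ⟨u, rfl⟩ := (hmk z z').1 h
    refine ⟨-(β.im * u.re) - (β.re + β.im) * u.im, ?_⟩
    simp [alpha]
    ring
  have hmodρ : ∀ z, (3 : ℤ) ∣ ((ρ z).re - (ρ z).im) - (z.re - z.im) - (c.re - c.im) := by
    intro z
    refine ⟨-z.re, ?_⟩
    simp only [hρ, alpha_pow_two]
    simp
    ring
  have hne : ∀ z, I.mkQ z ≠ I.mkQ (ρ z) ∧ I.mkQ z ≠ I.mkQ (ρ (ρ z)) ∧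
      I.mkQ (ρ z) ≠ I.mkQ (ρ (ρ z)) := by
    intro z
    have h1 := hmodρ z
    have h2 := hmodρ (ρ z)
    refine ⟨fun h => ?_, fun h => ?_, fun h => ?_⟩ <;> have := hmod _ _ h <;> omega
  have hwell : ∀ z z' : Eisenstein, I.mkQ z = I.mkQ z' →
      toQuotient β (face z) = toQuotient β (face z') := fun z z' h => (hiff z z').2 (.inl h)
  let ψ : Eisenstein ⧸ I → MulAction.orbitRel.Quotient (rotationGroup β) (Finset Eisenstein) :=
    fun q => toQuotient β (face (Function.surjInv I.mkQ_surjective q))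
  have hψ : ∀ z, ψ (I.mkQ z) = toQuotient β (face z) :=
    fun z => hwell _ _ (Function.surjInv_eq I.mkQ_surjective _)
  have himage : toQuotient β '' Set.range face = ((Finset.univ.image ψ : Finset _) : Set _) := by
    ext q
    simp only [Set.mem_image, Set.mem_range, exists_exists_eq_and, Finset.coe_image,
      Finset.coe_univ, Set.image_univ]
    constructor
    · rintro ⟨z, rfl⟩
      exact ⟨I.mkQ z, hψ z⟩
    · rintro ⟨q, rfl⟩
      exact ⟨_, rfl⟩
  rw [himage, Set.ncard_coe_finset, Nat.card_eq_fintype_card, ← Finset.card_univ,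
    Finset.card_eq_sum_card_image ψ, mul_comm, Finset.sum_const_nat]
  intro q hq
  obtain ⟨q, -, rfl⟩ := Finset.mem_image.1 hq
  obtain ⟨z, rfl⟩ := I.mkQ_surjective q
  rw [Finset.card_eq_three]
  obtain ⟨h1, h2, h3⟩ := hne z
  refine ⟨_, _, _, h1, h2, h3, ?_⟩
  ext q
  obtain ⟨z', rfl⟩ := I.mkQ_surjective q
  simp only [Finset.mem_filter, Finset.mem_univ, true_and, Finset.mem_insert,
    Finset.mem_singleton, hψ]
  exact hiff z' z

theorem image_sq_up (z : Eisenstein) : (up z).image (alpha ^ 2 * ·) = up (alpha ^ 2 * z + -1) := by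
  rw [image_sq_eq, image_alpha_up, image_alpha_down, pow_two, mul_assoc, sub_eq_add_neg]

theorem image_sq_down (z : Eisenstein) :
    (down z).image (alpha ^ 2 * ·) = down (alpha ^ 2 * z + -alpha) := by
  rw [image_sq_eq, image_alpha_down, image_alpha_up]
  congr 1
  ring

theorem exists_image_pow_down (i : ℕ) (w : Eisenstein) :
    ∃ w', (down w).image (alpha ^ (2 * i) * ·) = down w' := by
  induction i with
  | zero => exact ⟨w, by simp⟩
  | succ i ih =>
    obtain ⟨w', h⟩ := ih
    refine ⟨alpha ^ 2 * w' + -alpha, ?_⟩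
    rw [← image_sq_down, ← h, image_image_mul, ← pow_add]
    congr! 3
    ring

theorem toQuotient_up_ne_down (β z w : Eisenstein) :
    toQuotient β (up z) ≠ toQuotient β (down w) := by
  intro h
  obtain ⟨i, u, h⟩ := toQuotient_eq_iff.1 h
  obtain ⟨w', hw'⟩ := exists_image_pow_down i w
  rw [hw', vadd_down] at h
  exact up_ne_down _ _ h

theorem faceCount_eq {β : Eisenstein} (hx : 0 < β.re) (hy : 0 < β.im) :
    (faceCount β : ℤ) = 2 * (β.re ^ 2 + β.re * β.im + β.im ^ 2) := by
  have hcard := card_quotient_translationLattice hx hy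
  have h1 := three_mul_ncard_toQuotient hx hy up_injective image_sq_up vadd_up
    (by simp)
  have h2 := three_mul_ncard_toQuotient hx hy down_injective image_sq_down vadd_down
    (by simp [alpha])
  have hpos : 0 < β.re ^ 2 + β.re * β.im + β.im ^ 2 := by positivity
  have hfaces : faces = Set.range up ∪ Set.range down := by
    ext t
    constructor
    · intro ht
      obtain ⟨z, rfl | rfl⟩ := eq_up_or_eq_down ht
      · exact .inl ⟨z, rfl⟩
      · exact .inr ⟨z, rfl⟩
    · rintro (⟨z, rfl⟩ | ⟨z, rfl⟩)
      · exact up_mem_faces z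
      · exact down_mem_faces z
  rw [faceCount, hfaces, Set.image_union, Set.ncard_union_eq _ (Set.finite_of_ncard_pos (by omega))
    (Set.finite_of_ncard_pos (by omega))]
  · push_cast
    omega
  · rw [Set.disjoint_left]
    rintro _ ⟨_, ⟨z, rfl⟩, rfl⟩ ⟨_, ⟨w, rfl⟩, h⟩
    exact toQuotient_up_ne_down β z w h.symm

/-! ### The subtractive Euclidean algorithm for real numbers -/

theorem euclid_smul {c : ℝ} (hc : 0 < c) (p : ℝ × ℝ) : euclid (c • p) = c • euclid p := by
  simp only [euclid, Prod.smul_fst, Prod.smul_snd, smul_eq_mul, mul_lt_mul_iff_right₀ hc]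
  split_ifs <;> ext <;> simp [mul_sub]

theorem iterate_euclid_smul {c : ℝ} (hc : 0 < c) (p : ℝ × ℝ) (k : ℕ) :
    euclid^[k] (c • p) = c • euclid^[k] p := by
  induction k with
  | zero => rfl
  | succ k ih => rw [Function.iterate_succ_apply', ih, euclid_smul hc, Function.iterate_succ_apply']

/-- A pair of integers as a pair of real numbers. -/
def castPair (p : ℤ × ℤ) : ℝ × ℝ := (p.1, p.2)

theorem castPair_layer (p : ℤ × ℤ) (k : ℕ) : castPair (layer p k) = euclid^[k] (castPair p) := by
  induction k with
  | zero => rfl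
  | succ k ih =>
    rw [layer_succ, Function.iterate_succ_apply', ← ih]
    simp only [euclid, castPair, Int.cast_lt]
    split_ifs <;> simp

theorem iterate_euclid_div {a b : ℤ} (hb : 0 < b) (k : ℕ) :
    castPair (layer (a, b) k) = (b : ℝ) • euclid^[k] ((a : ℝ) / b, (1 : ℝ)) := by
  have hb' : (0 : ℝ) < b := by exact_mod_cast hb
  rw [castPair_layer, ← iterate_euclid_smul hb']
  congr 1
  simp only [castPair, Prod.smul_mk, smul_eq_mul, mul_one]
  rw [mul_div_cancel₀ _ hb'.ne']

theorem weight_castPair (p : ℤ × ℤ) : weight (castPair p) = (weight p : ℤ) := by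
  simp only [weight, castPair, Int.cast_pos]
  split_ifs <;> simp

theorem weight_smul {c : ℝ} (hc : 0 < c) (p : ℝ × ℝ) : weight (c • p) = c * weight p := by
  simp only [weight, Prod.smul_fst, Prod.smul_snd, smul_eq_mul, mul_pos_iff_of_pos_left hc]
  split_ifs <;> ring

theorem weight_layer {a b : ℤ} (hb : 0 < b) (k : ℕ) :
    ((weight (layer (a, b) k) : ℤ) : ℝ) = b * weight (euclid^[k] ((a : ℝ) / b, (1 : ℝ))) := by
  rw [← weight_castPair, iterate_euclid_div hb, weight_smul (by exact_mod_cast hb)]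

/-- A pair of positive real numbers which are linearly independent over `ℚ`. -/
def Incommensurable (p : ℝ × ℝ) : Prop :=
  0 < p.1 ∧ 0 < p.2 ∧ ∀ m n : ℤ, m * p.1 + n * p.2 = 0 → m = 0 ∧ n = 0

theorem Incommensurable.ne {p : ℝ × ℝ} (hp : Incommensurable p) : p.1 ≠ p.2 := by
  intro h
  have := (hp.2.2 1 (-1) (by push_cast; linarith)).1
  omega

theorem Incommensurable.euclid {p : ℝ × ℝ} (hp : Incommensurable p) :
    Incommensurable (euclid p) := by
  have hne := hp.ne
  obtain ⟨h1, h2, h⟩ := hp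
  simp only [Eisenstein.euclid]
  split_ifs with hlt
  · refine ⟨h1, by simpa using hlt, fun m n hmn => ?_⟩
    have := h (m - n) n (by push_cast; simp only at hmn; linarith)
    omega
  · refine ⟨by simpa using lt_of_le_of_ne (not_lt.1 hlt) hne.symm, h2, fun m n hmn => ?_⟩
    have := h m (n - m) (by push_cast; simp only at hmn; linarith)
    omega

theorem Incommensurable.iterate {p : ℝ × ℝ} (hp : Incommensurable p) (k : ℕ) :
    Incommensurable (Eisenstein.euclid^[k] p) := by
  induction k with
  | zero => exact hp
  | succ k ih => rw [Function.iterate_succ_apply']; exact ih.euclid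

theorem incommensurable_of_irrational {ζ : ℝ} (h : Irrational ζ) (hpos : 0 < ζ) :
    Incommensurable (ζ, 1) := by
  refine ⟨hpos, one_pos, fun m n hmn => ?_⟩
  simp only [mul_one] at hmn
  by_cases hm : m = 0
  · subst hm
    simpa using hmn
  · exfalso
    refine (h.intCast_mul hm).ne_int (-n) ?_
    push_cast
    linarith

theorem sum_euclid (p : ℝ × ℝ) :
    (euclid p).1 + (euclid p).2 = p.1 + p.2 - min p.1 p.2 := by
  simp only [euclid]
  split_ifs with h
  · rw [min_eq_left h.le]; ring
  · rw [min_eq_right (not_lt.1 h)]; ring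

theorem continuousAt_euclid {p : ℝ × ℝ} (hp : p.1 ≠ p.2) : ContinuousAt euclid p := by
  rcases lt_or_gt_of_ne hp with h | h
  · have : euclid =ᶠ[nhds p] fun q : ℝ × ℝ => (q.1, q.2 - q.1) := by
      filter_upwards [(isOpen_lt continuous_fst continuous_snd).mem_nhds h] with q hq
      have hq' : q.1 < q.2 := hq
      simp [euclid, hq']
    refine ContinuousAt.congr ?_ this.symm
    fun_prop
  · have : euclid =ᶠ[nhds p] fun q : ℝ × ℝ => (q.1 - q.2, q.2) := by
      filter_upwards [(isOpen_lt continuous_snd continuous_fst).mem_nhds h] with q hq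
      have hq' : ¬ q.1 < q.2 := not_lt.2 (le_of_lt hq)
      simp [euclid, hq']
    refine ContinuousAt.congr ?_ this.symm
    fun_prop

theorem Incommensurable.continuousAt_iterate {p : ℝ × ℝ} (hp : Incommensurable p) (k : ℕ) :
    ContinuousAt (Eisenstein.euclid^[k]) p := by
  induction k with
  | zero => exact continuousAt_id
  | succ k ih =>
    rw [Function.iterate_succ']
    exact ContinuousAt.comp (continuousAt_euclid (hp.iterate k).ne) ih

theorem continuousAt_weight {p : ℝ × ℝ} (hp : 0 < p.1) : ContinuousAt weight p := by
  have : weight =ᶠ[nhds p] fun q : ℝ × ℝ => q.1 + q.2 := by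
    filter_upwards [(isOpen_lt continuous_const continuous_fst).mem_nhds hp] with q hq
    exact if_pos hq
  refine ContinuousAt.congr ?_ this.symm
  fun_prop

/-- The subtractive Euclidean algorithm drives an incommensurable pair to `(0, 0)`. -/
theorem Incommensurable.tendsto_sum {p : ℝ × ℝ} (hp : Incommensurable p) :
    Filter.Tendsto (fun k => (Eisenstein.euclid^[k] p).1 + (Eisenstein.euclid^[k] p).2)
      Filter.atTop (nhds 0) := by
  set v := fun k => Eisenstein.euclid^[k] p with hv
  have hsucc : ∀ k, v (k + 1) = Eisenstein.euclid (v k) :=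
    fun k => Function.iterate_succ_apply' _ _ _
  have hinc : ∀ k, Incommensurable (v k) := hp.iterate
  set s := fun k => (v k).1 + (v k).2 with hs
  have hstep : ∀ k, s (k + 1) = s k - min (v k).1 (v k).2 := fun k => by
    simp only [hs, hsucc, sum_euclid]
  have hmin : ∀ k, 0 < min (v k).1 (v k).2 := fun k => lt_min (hinc k).1 (hinc k).2.1
  have hanti : Antitone s := antitone_nat_of_succ_le fun k => by linarith [hstep k, hmin k]
  have hbdd : BddBelow (Set.range s) :=
    ⟨0, by rintro _ ⟨k, rfl⟩; exact (add_pos (hinc k).1 (hinc k).2.1).le⟩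
  have hlim := tendsto_atTop_ciInf hanti hbdd
  set l := ⨅ k, s k
  have hl : ∀ k, l ≤ s k := fun k => ciInf_le hbdd k
  have hl0 : 0 ≤ l := le_ciInf fun k => (add_pos (hinc k).1 (hinc k).2.1).le
  rcases hl0.eq_or_lt with h0 | h0
  · rwa [← h0] at hlim
  exfalso
  have hmin0 : Filter.Tendsto (fun k => min (v k).1 (v k).2) Filter.atTop (nhds 0) := by
    have := hlim.sub (hlim.comp (Filter.tendsto_add_atTop_nat 1))
    rw [sub_self] at this
    refine this.congr fun k => ?_
    simp only [Function.comp]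
    linarith [hstep k]
  -- If the sum stays away from `0` while the minimum tends to `0`, then eventually the same
  -- component is subtracted for ever, and the minimum does not change any more.
  obtain ⟨K, hK⟩ := Filter.eventually_atTop.1
    (hmin0.eventually (gt_mem_nhds (show (0 : ℝ) < l / 3 by linarith)))
  have hconst : ∀ k ≥ K, min (v (k + 1)).1 (v (k + 1)).2 = min (v k).1 (v k).2 := by
    intro k hk
    have h1 := hK k hk
    have h2 := hl k
    simp only [hs] at h2
    rw [hsucc, Eisenstein.euclid]
    split_ifs with h
    · rw [min_eq_left h.le] at h1 ⊢
      exact min_eq_left (by simp only; linarith)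
    · rw [min_eq_right (not_lt.1 h)] at h1 ⊢
      exact min_eq_right (by simp only; linarith)
  have hconst' : ∀ j, min (v (K + j)).1 (v (K + j)).2 = min (v K).1 (v K).2 := by
    intro j
    induction j with
    | zero => rfl
    | succ j ih => rw [← ih, ← add_assoc, hconst _ (Nat.le_add_right _ _)]
  have := hmin0.comp (Filter.tendsto_add_atTop_nat K)
  refine (hmin K).ne' (tendsto_nhds_unique ?_ this)
  refine tendsto_const_nhds.congr fun j => ?_
  simp only [Function.comp]
  rw [add_comm, hconst']

/-! ### Bounded pieces of the sum over the layers -/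

theorem layer_euclid (p : ℤ × ℤ) (k : ℕ) : layer (euclid p) k = layer p (k + 1) := rfl

theorem Admissible.sum_euclid {p : ℤ × ℤ} (hp : Admissible p) :
    (Eisenstein.euclid p).1 + (Eisenstein.euclid p).2 + weight p ≤
        (p.1 + p.2) + (p.1 + p.2) ∧
    (Eisenstein.euclid p).1 + (Eisenstein.euclid p).2 ≤ p.1 + p.2 ∧
    0 < (Eisenstein.euclid p).1 + (Eisenstein.euclid p).2 ∧
    (0 < p.1 → (Eisenstein.euclid p).1 + (Eisenstein.euclid p).2 + 1 ≤ p.1 + p.2) := by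
  have h' := hp.euclid.nonneg
  have h := hp.nonneg
  simp only [weight]
  simp only [Eisenstein.euclid] at h' ⊢
  split_ifs at h' ⊢ <;> simp only at h' ⊢ <;> omega

theorem sum_weight_le_sq {p : ℤ × ℤ} (hp : Admissible p) (K : ℕ) :
    ∑ k ∈ Finset.range K, weight (layer p k) ≤ (p.1 + p.2) ^ 2 := by
  induction K generalizing p with
  | zero => simpa using sq_nonneg _
  | succ K ih =>
    rw [Finset.sum_range_succ']
    have := ih hp.euclid
    simp only [layer_euclid] at this
    obtain ⟨-, h2, h3, h4⟩ := hp.sum_euclid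
    have h5 := hp.nonneg
    change _ + weight p ≤ _
    rw [weight]
    split_ifs with h0
    · nlinarith [h4 h0]
    · nlinarith

/-- The first `m` layers contribute at most `x + y` each, and the remaining ones form a flower which
is small compared with the whole one. -/
theorem sum_weight_le {p : ℤ × ℤ} (hp : Admissible p) (K m : ℕ) :
    ∑ k ∈ Finset.range K, weight (layer p k) ≤
      m * (p.1 + p.2) + ((layer p m).1 + (layer p m).2) ^ 2 := by
  induction m generalizing p K with
  | zero => simpa [layer] using sum_weight_le_sq hp K
  | succ m ih =>
    obtain ⟨h1, h2, -, -⟩ := hp.sum_euclid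
    have h5 := hp.nonneg
    rcases K with _ | K
    · simp only [Finset.range_zero, Finset.sum_empty]
      have : 0 ≤ p.1 + p.2 := by omega
      positivity
    · rw [Finset.sum_range_succ']
      have := ih hp.euclid K
      simp only [layer_euclid] at this
      have hw : weight (layer p 0) ≤ p.1 + p.2 := by
        change weight p ≤ _
        rw [weight]
        split_ifs <;> omega
      push_cast
      nlinarith [mul_le_mul_of_nonneg_left h2 (Nat.cast_nonneg (α := ℤ) m)]

/-! ### Periodicity of the algorithm at quadratic irrationals -/

/-- The binary quadratic form `A X² + B X Y + C Y²` of discriminant `D`, given as `(A, B, C)`, has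
non-zero outer coefficients and vanishes at `p`. -/
def IsForm (D : ℤ) (p : ℝ × ℝ) (q : ℤ × ℤ × ℤ) : Prop :=
  q.1 * p.1 ^ 2 + q.2.1 * (p.1 * p.2) + q.2.2 * p.2 ^ 2 = 0 ∧
    q.2.1 ^ 2 - 4 * (q.1 * q.2.2) = D ∧ q.1 ≠ 0 ∧ q.2.2 ≠ 0

theorem Incommensurable.coeff_ne_zero {p : ℝ × ℝ} (hp : Incommensurable p) {A B C D : ℤ}
    (h : A * p.1 ^ 2 + B * (p.1 * p.2) + C * p.2 ^ 2 = 0) (hD : B ^ 2 - 4 * (A * C) = D)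
    (hD0 : D ≠ 0) : A ≠ 0 ∧ C ≠ 0 := by
  constructor
  · rintro rfl
    have : p.2 * (B * p.1 + C * p.2) = 0 := by push_cast at h; linarith
    have := hp.2.2 B C ((mul_eq_zero.1 this).resolve_left hp.2.1.ne')
    exact hD0 (by rw [← hD, this.1]; ring)
  · rintro rfl
    have : p.1 * (A * p.1 + B * p.2) = 0 := by push_cast at h; linarith
    have := hp.2.2 A B ((mul_eq_zero.1 this).resolve_left hp.1.ne')
    exact hD0 (by rw [← hD, this.2]; ring)

/-- The action of one step of the algorithm on quadratic forms. -/
theorem IsForm.euclid {D : ℤ} {p : ℝ × ℝ} (hp : Incommensurable p) (hD : D ≠ 0) {A B C : ℤ}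
    (h : IsForm D p (A, B, C)) :
    (p.1 < p.2 → IsForm D (euclid p) (A + B + C, B + 2 * C, C)) ∧
      (p.2 < p.1 → IsForm D (euclid p) (A, B + 2 * A, A + B + C)) := by
  obtain ⟨h1, h2, -, -⟩ := h
  simp only at h1 h2
  have key : ∀ q : ℤ × ℤ × ℤ,
      q.1 * (Eisenstein.euclid p).1 ^ 2 +
          q.2.1 * ((Eisenstein.euclid p).1 * (Eisenstein.euclid p).2) +
          q.2.2 * (Eisenstein.euclid p).2 ^ 2 = 0 →
      q.2.1 ^ 2 - 4 * (q.1 * q.2.2) = D → IsForm D (Eisenstein.euclid p) q :=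
    fun q hq hq' => ⟨hq, hq', hp.euclid.coeff_ne_zero hq hq' hD⟩
  constructor
  · intro hlt
    refine key _ ?_ ?_
    · simp only [Eisenstein.euclid, hlt, if_true]
      push_cast
      linear_combination h1
    · simp only
      linear_combination h2
  · intro hlt
    refine key _ ?_ ?_
    · simp only [Eisenstein.euclid, hlt.not_gt, if_false]
      push_cast
      linear_combination h1
    · simp only
      linear_combination h2

/-- Forms whose outer coefficients have opposite signs (the conjugate root is then negative) are
mapped to forms of the same kind. -/
theorem IsForm.exists_euclid_neg {D : ℤ} {p : ℝ × ℝ} (hp : Incommensurable p) (hD : D ≠ 0)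
    {q : ℤ × ℤ × ℤ} (h : IsForm D p q) (hq : q.1 * q.2.2 < 0) :
    ∃ q', IsForm D (Eisenstein.euclid p) q' ∧ q'.1 * q'.2.2 < 0 := by
  obtain ⟨A, B, C⟩ := q
  simp only at hq
  have hx := hp.1
  have hy := hp.2.1
  have hform := h.1
  simp only at hform
  have hq' : (A : ℝ) * C < 0 := by exact_mod_cast hq
  rcases lt_or_gt_of_ne hp.ne with hlt | hlt
  · refine ⟨_, (h.euclid hp hD).1 hlt, ?_⟩
    simp only
    -- `C (A + B + C)` has the sign of `C (y - x) (A x - C y)`.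
    have e : p.1 * p.2 * (((A : ℝ) + B + C) * C) =
        (p.2 - p.1) * (A * C * p.1 - C ^ 2 * p.2) := by
      linear_combination (C : ℝ) * hform
    have hneg : (p.2 - p.1) * (A * C * p.1 - C ^ 2 * p.2) < 0 := by
      refine mul_neg_of_pos_of_neg (by linarith) ?_
      nlinarith [mul_pos_of_neg_of_neg hq' (neg_lt_zero.2 hx), mul_nonneg (sq_nonneg (C : ℝ)) hy.le]
    have : ((A : ℝ) + B + C) * C < 0 := by
      rw [← e] at hneg
      exact (pos_iff_neg_of_mul_neg hneg).1 (mul_pos hx hy)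
    exact_mod_cast this
  · refine ⟨_, (h.euclid hp hD).2 hlt, ?_⟩
    simp only
    have e : p.1 * p.2 * (A * ((A : ℝ) + B + C)) =
        (p.1 - p.2) * (A * C * p.2 - A ^ 2 * p.1) := by
      linear_combination (A : ℝ) * hform
    have hneg : (p.1 - p.2) * (A * C * p.2 - A ^ 2 * p.1) < 0 := by
      refine mul_neg_of_pos_of_neg (by linarith) ?_
      nlinarith [mul_pos_of_neg_of_neg hq' (neg_lt_zero.2 hy), mul_nonneg (sq_nonneg (A : ℝ)) hx.le]
    have : A * ((A : ℝ) + B + C) < 0 := by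
      rw [← e] at hneg
      exact (pos_iff_neg_of_mul_neg hneg).1 (mul_pos hx hy)
    exact_mod_cast this

/-- After finitely many steps the outer coefficients have opposite signs: as long as they are both
positive, the middle coefficient is negative and increases in every step. -/
theorem exists_isForm_neg {D : ℤ} {p : ℝ × ℝ} (hp : Incommensurable p) (hD : D ≠ 0)
    {q : ℤ × ℤ × ℤ} (h : IsForm D p q) (hA : 0 < q.1) :
    ∃ m q', IsForm D (euclid^[m] p) q' ∧ q'.1 * q'.2.2 < 0 := by
  by_contra! H
  have key : ∀ k : ℕ, ∃ q', IsForm D (euclid^[k] p) q' ∧ 0 < q'.1 ∧ 0 < q'.2.2 ∧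
      q.2.1 + 2 * k ≤ q'.2.1 := by
    intro k
    induction k with
    | zero =>
      refine ⟨q, h, hA, ?_, by simp⟩
      have h0 := H 0 q h
      have := h.2.2.2
      by_contra! hC
      nlinarith [lt_of_le_of_ne hC this]
    | succ k ih =>
      obtain ⟨⟨A, B, C⟩, hq, h1, h2, h3⟩ := ih
      simp only at h1 h2 h3
      have hk := hp.iterate k
      rcases lt_or_gt_of_ne hk.ne with hlt | hlt
      · have hnew := (hq.euclid hk hD).1 hlt
        rw [← Function.iterate_succ_apply' euclid] at hnew
        refine ⟨_, hnew, ?_, h2, ?_⟩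
        · have := H (k + 1) _ hnew
          have hne := hnew.2.2.1
          simp only at this hne ⊢
          by_contra! hC
          nlinarith [lt_of_le_of_ne hC hne]
        · push_cast; omega
      · have hnew := (hq.euclid hk hD).2 hlt
        rw [← Function.iterate_succ_apply' euclid] at hnew
        refine ⟨_, hnew, h1, ?_, ?_⟩
        · have := H (k + 1) _ hnew
          have hne := hnew.2.2.2
          simp only at this hne ⊢
          by_contra! hC
          nlinarith [lt_of_le_of_ne hC hne]
        · push_cast; omega
  obtain ⟨⟨A, B, C⟩, hq, h1, h2, h3⟩ := key q.2.1.natAbs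
  simp only at h1 h2 h3
  have hB : 0 ≤ B := by omega
  have hk := hp.iterate q.2.1.natAbs
  have hform := hq.1
  simp only at hform
  have h1' : (0 : ℝ) < A := by exact_mod_cast h1
  have h2' : (0 : ℝ) < C := by exact_mod_cast h2
  have hB' : (0 : ℝ) ≤ B := by exact_mod_cast hB
  have := mul_pos h1' (pow_pos hk.1 2)
  have := mul_pos h2' (pow_pos hk.2.1 2)
  have := mul_nonneg hB' (mul_pos hk.1 hk.2.1).le
  linarith

theorem IsForm.bounds {D : ℤ} {p : ℝ × ℝ} {q : ℤ × ℤ × ℤ} (h : IsForm D p q)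
    (hq : q.1 * q.2.2 < 0) : |q.1| ≤ D ∧ |q.2.1| ≤ D ∧ |q.2.2| ≤ D := by
  obtain ⟨A, B, C⟩ := q
  obtain ⟨-, h2, h3, h4⟩ := h
  simp only at hq h2 h3 h4 ⊢
  have hA : 1 ≤ |A| := Int.one_le_abs h3
  have hC : 1 ≤ |C| := Int.one_le_abs h4
  have hAC : |A| * |C| = -(A * C) := by rw [← abs_mul, abs_of_neg hq]
  have hB : |B| ≤ B ^ 2 := by
    rw [← sq_abs]
    nlinarith [abs_nonneg B, Int.le_self_sq |B|]
  refine ⟨?_, ?_, ?_⟩ <;> nlinarith [sq_nonneg B]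

/-- A form with outer coefficients of opposite signs has only one positive root. -/
theorem IsForm.mul_eq_mul {D : ℤ} {p p' : ℝ × ℝ} {q : ℤ × ℤ × ℤ} (hp : Incommensurable p)
    (hp' : Incommensurable p') (h : IsForm D p q) (h' : IsForm D p' q) (hq : q.1 * q.2.2 < 0) :
    p.1 * p'.2 = p'.1 * p.2 := by
  obtain ⟨A, B, C⟩ := q
  have h1 := h.1
  have h1' := h'.1
  simp only at h1 h1' hq
  have hq' : (A : ℝ) * C < 0 := by exact_mod_cast hq
  have e : (p.1 * p'.2 - p'.1 * p.2) *
      (A * (p.1 * p'.2 + p'.1 * p.2) + B * (p.2 * p'.2)) = 0 := by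
    linear_combination p'.2 ^ 2 * h1 - p.2 ^ 2 * h1'
  rcases mul_eq_zero.1 e with e | e
  · linarith
  · exfalso
    have e2 : p.2 * (A * (p.1 * p'.1) - C * (p.2 * p'.2)) = 0 := by
      linear_combination p.1 * e - p'.2 * h1
    have e3 := (mul_eq_zero.1 e2).resolve_left hp.2.1.ne'
    have h5 : 0 < (A : ℝ) ^ 2 * (p.1 * p'.1) := by
      have : (A : ℝ) ≠ 0 := by
        intro h0
        rw [h0] at hq'
        simp at hq'
      have := mul_pos hp.1 hp'.1
      positivity
    have h6 : (A : ℝ) * C * (p.2 * p'.2) < 0 :=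
      mul_neg_of_neg_of_pos hq' (mul_pos hp.2.1 hp'.2.1)
    have e4 : (A : ℝ) ^ 2 * (p.1 * p'.1) = A * C * (p.2 * p'.2) := by
      linear_combination (A : ℝ) * e3
    linarith

/-- The ratio of the components is bounded in terms of the discriminant. -/
theorem IsForm.le_two_mul {D : ℤ} {p : ℝ × ℝ} {q : ℤ × ℤ × ℤ} (hp : Incommensurable p)
    (h : IsForm D p q) (hq : q.1 * q.2.2 < 0) :
    p.1 ≤ 2 * D * p.2 ∧ p.2 ≤ 2 * D * p.1 := by
  obtain ⟨b1, b2, b3⟩ := h.bounds hq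
  obtain ⟨A, B, C⟩ := q
  obtain ⟨h1, -, h3, h4⟩ := h
  simp only at b1 b2 b3 h1 h3 h4
  obtain ⟨hx, hy, -⟩ := hp
  have hA : (1 : ℝ) ≤ |(A : ℝ)| := by exact_mod_cast Int.one_le_abs h3
  have hC : (1 : ℝ) ≤ |(C : ℝ)| := by exact_mod_cast Int.one_le_abs h4
  have b1' : |(A : ℝ)| ≤ D := by exact_mod_cast b1
  have b2' : |(B : ℝ)| ≤ D := by exact_mod_cast b2
  have b3' : |(C : ℝ)| ≤ D := by exact_mod_cast b3
  have hD : (1 : ℝ) ≤ D := hA.trans b1'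
  have aux : ∀ a b c x y : ℝ, 0 < x → 0 < y → 1 ≤ |a| → |b| ≤ D → |c| ≤ D →
      a * x ^ 2 + b * (x * y) + c * y ^ 2 = 0 → x ≤ 2 * D * y := by
    intro a b c x y hx hy ha hb hc h
    rcases le_total x y with hxy | hxy
    · nlinarith
    · have h1 : |a| * x ^ 2 ≤ |b| * (x * y) + |c| * y ^ 2 := by
        have : a * x ^ 2 = -(b * (x * y) + c * y ^ 2) := by linarith
        calc |a| * x ^ 2 = |a * x ^ 2| := by rw [abs_mul, abs_of_pos (pow_pos hx 2)]
          _ = |b * (x * y) + c * y ^ 2| := by rw [this, abs_neg]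
          _ ≤ |b * (x * y)| + |c * y ^ 2| := abs_add_le _ _
          _ = _ := by
            rw [abs_mul, abs_mul c, abs_of_pos (pow_pos hy 2), abs_of_pos (mul_pos hx hy)]
      have h2 : |b| * (x * y) ≤ D * (x * y) := mul_le_mul_of_nonneg_right hb (mul_pos hx hy).le
      have h3 : |c| * y ^ 2 ≤ D * (x * y) :=
        mul_le_mul hc (by nlinarith) (sq_nonneg y) (by linarith)
      have h4 : x ^ 2 ≤ |a| * x ^ 2 := le_mul_of_one_le_left (sq_nonneg x) ha
      have h5 : x * x ≤ x * (2 * D * y) := by nlinarith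
      exact le_of_mul_le_mul_left h5 hx
  exact ⟨aux A B C _ _ hx hy hA b2' b3' h1,
    aux C B A _ _ hy hx hC b2' b1' (by linarith)⟩

/-- The subtractive Euclidean algorithm is eventually periodic up to scaling at a quadratic
irrational, and the ratios of its components are bounded. -/
theorem exists_period {ζ : ℝ} (hζ : Irrational ζ) (hpos : 0 < ζ) {A B C : ℤ} (hA : 0 < A)
    (h : A * ζ ^ 2 + B * ζ + C = 0) :
    (∃ κ : ℝ, 0 < κ ∧ ∀ k, κ * max (euclid^[k] (ζ, (1 : ℝ))).1 (euclid^[k] (ζ, (1 : ℝ))).2 ≤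
      min (euclid^[k] (ζ, (1 : ℝ))).1 (euclid^[k] (ζ, (1 : ℝ))).2) ∧
    ∃ i j, i < j ∧ (euclid^[i] (ζ, (1 : ℝ))).1 * (euclid^[j] (ζ, (1 : ℝ))).2 =
      (euclid^[j] (ζ, (1 : ℝ))).1 * (euclid^[i] (ζ, (1 : ℝ))).2 := by
  have hp := incommensurable_of_irrational hζ hpos
  set v := fun k => euclid^[k] (ζ, (1 : ℝ)) with hv
  have hv' : ∀ k, euclid^[k] (ζ, (1 : ℝ)) = v k := fun _ => rfl
  simp only [hv']
  have hinc : ∀ k, Incommensurable (v k) := hp.iterate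
  set D := B ^ 2 - 4 * (A * C) with hD
  have hD0 : D ≠ 0 := by
    intro h0
    have h0' : (B : ℝ) ^ 2 - 4 * (A * C) = 0 := by rw [hD] at h0; exact_mod_cast h0
    have : ((2 * A : ℤ) * ζ + (B : ℤ) * 1) ^ 2 = (0 : ℝ) := by
      push_cast
      linear_combination 4 * (A : ℝ) * h + h0'
    have := (hp.2.2 (2 * A) B (pow_eq_zero_iff two_ne_zero |>.1 this)).1
    omega
  have hform0 : (A : ℝ) * (ζ, (1 : ℝ)).1 ^ 2 + B * ((ζ, (1 : ℝ)).1 * (ζ, (1 : ℝ)).2) +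
      C * (ζ, (1 : ℝ)).2 ^ 2 = 0 := by
    simp only
    linear_combination h
  obtain ⟨m, q, hq, hq'⟩ := exists_isForm_neg hp hD0 (q := (A, B, C))
    ⟨hform0, hD.symm, hp.coeff_ne_zero hform0 hD.symm hD0⟩ hA
  have hall : ∀ k, ∃ q, IsForm D (v (m + k)) q ∧ q.1 * q.2.2 < 0 := by
    intro k
    induction k with
    | zero => exact ⟨q, hq, hq'⟩
    | succ k ih =>
      obtain ⟨q, h1, h2⟩ := ih
      have := h1.exists_euclid_neg (hinc _) hD0 h2
      rw [hv, ← add_assoc]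
      simp only
      rw [Function.iterate_succ_apply']
      exact this
  choose f hf hf' using hall
  have hDpos : 0 < D := by
    have := (hf 0).2.1
    nlinarith [sq_nonneg (f 0).2.1, hf' 0]
  constructor
  · have hlate : ∀ n, m ≤ n → 1 / (2 * D) * max (v n).1 (v n).2 ≤ min (v n).1 (v n).2 := by
      intro n hn
      obtain ⟨k, rfl⟩ := Nat.exists_eq_add_of_le hn
      obtain ⟨h1, h2⟩ := (hf k).le_two_mul (hinc _) (hf' k)
      have hD' : (1 : ℝ) ≤ D := by exact_mod_cast hDpos
      obtain ⟨hx, hy, -⟩ := hinc (m + k)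
      rw [one_div, inv_mul_le_iff₀ (by positivity)]
      rcases le_total (v (m + k)).1 (v (m + k)).2 with hle | hle
      · rwa [max_eq_right hle, min_eq_left hle]
      · rwa [max_eq_left hle, min_eq_right hle]
    have hdesc : ∀ n κ, 0 < κ → (∀ k, n ≤ k → κ * max (v k).1 (v k).2 ≤ min (v k).1 (v k).2) →
        ∃ κ : ℝ, 0 < κ ∧ ∀ k, κ * max (v k).1 (v k).2 ≤ min (v k).1 (v k).2 := by
      intro n
      induction n with
      | zero => exact fun κ hκ hk => ⟨κ, hκ, fun k => hk k (Nat.zero_le k)⟩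
      | succ n ih =>
        intro κ hκ hk
        have hmax : 0 < max (v n).1 (v n).2 := lt_max_of_lt_left (hinc n).1
        have hmin : 0 < min (v n).1 (v n).2 := lt_min (hinc n).1 (hinc n).2.1
        refine ih (min κ (min (v n).1 (v n).2 / max (v n).1 (v n).2))
          (lt_min hκ (div_pos hmin hmax)) fun k hnk => ?_
        have hmaxk : 0 < max (v k).1 (v k).2 := lt_max_of_lt_left (hinc k).1
        rcases eq_or_lt_of_le hnk with rfl | hlt
        · calc _ ≤ min (v n).1 (v n).2 / max (v n).1 (v n).2 * max (v n).1 (v n).2 :=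
                mul_le_mul_of_nonneg_right (min_le_right _ _) hmaxk.le
            _ = _ := div_mul_cancel₀ _ hmax.ne'
        · exact (mul_le_mul_of_nonneg_right (min_le_left _ _) hmaxk.le).trans (hk k hlt)
    have hD' : (0 : ℝ) < D := by exact_mod_cast hDpos
    exact hdesc m (1 / (2 * D)) (by positivity) hlate
  · let g : ℕ → Set.Icc ((-D, -D, -D) : ℤ × ℤ × ℤ) (D, D, D) := fun k => ⟨f k, by
      obtain ⟨b1, b2, b3⟩ := (hf k).bounds (hf' k)
      rw [abs_le] at b1 b2 b3
      exact ⟨⟨b1.1, b2.1, b3.1⟩, ⟨b1.2, b2.2, b3.2⟩⟩⟩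
    obtain ⟨i, j, hij, hg⟩ := Finite.exists_ne_map_eq_of_infinite g
    have hg' : f i = f j := congrArg Subtype.val hg
    have key : ∀ i j, f i = f j → (v (m + i)).1 * (v (m + j)).2 =
        (v (m + j)).1 * (v (m + i)).2 :=
      fun i j hij => (hf i).mul_eq_mul (hinc _) (hinc _) (hij ▸ hf j) (hf' i)
    rcases lt_or_gt_of_ne hij with hlt | hlt
    · exact ⟨m + i, m + j, by omega, key i j hg'⟩
    · exact ⟨m + j, m + i, by omega, key j i hg'.symm⟩

/-! ### The sum over the algorithm at a quadratic irrational -/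

/-- The sum of `x + y` over all steps of the algorithm converges if the ratios of the components are
bounded. -/
theorem summable_sum {p : ℝ × ℝ} (hp : Incommensurable p) {κ : ℝ} (hκ : 0 < κ)
    (h : ∀ k, κ * max (euclid^[k] p).1 (euclid^[k] p).2 ≤ min (euclid^[k] p).1 (euclid^[k] p).2) :
    Summable fun k => (euclid^[k] p).1 + (euclid^[k] p).2 := by
  set s := fun k => (euclid^[k] p).1 + (euclid^[k] p).2 with hs
  have hs0 : ∀ k, 0 < s k := fun k => add_pos (hp.iterate k).1 (hp.iterate k).2.1
  have hle : ∀ k, s (k + 1) ≤ (1 - κ / 2) * s k := by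
    intro k
    have h1 : s (k + 1) = s k - min (euclid^[k] p).1 (euclid^[k] p).2 := by
      simp only [hs, Function.iterate_succ_apply', sum_euclid]
    have h2 : s k ≤ 2 * max (euclid^[k] p).1 (euclid^[k] p).2 := by
      simp only [hs]
      linarith [le_max_left (euclid^[k] p).1 (euclid^[k] p).2,
        le_max_right (euclid^[k] p).1 (euclid^[k] p).2]
    have h3 := h k
    nlinarith
  have hκ1 : 0 ≤ 1 - κ / 2 := by
    by_contra! hneg
    nlinarith [hs0 0, hs0 1, hle 0]
  have hgeo : ∀ k, s k ≤ s 0 * (1 - κ / 2) ^ k := by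
    intro k
    induction k with
    | zero => simp
    | succ k ih =>
      calc s (k + 1) ≤ (1 - κ / 2) * s k := hle k
        _ ≤ (1 - κ / 2) * (s 0 * (1 - κ / 2) ^ k) := mul_le_mul_of_nonneg_left ih hκ1
        _ = _ := by ring
  exact Summable.of_nonneg_of_le (fun k => (hs0 k).le) hgeo
    ((summable_geometric_of_lt_one hκ1 (by linarith)).mul_left _)

theorem iterate_mem {K : IntermediateField ℚ ℝ} {p : ℝ × ℝ} (h1 : p.1 ∈ K) (h2 : p.2 ∈ K)
    (k : ℕ) : (euclid^[k] p).1 ∈ K ∧ (euclid^[k] p).2 ∈ K := by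
  induction k with
  | zero => exact ⟨h1, h2⟩
  | succ k ih =>
    rw [Function.iterate_succ_apply', euclid]
    split_ifs
    · exact ⟨ih.1, sub_mem ih.2 ih.1⟩
    · exact ⟨sub_mem ih.1 ih.2, ih.2⟩

/-- If the algorithm is periodic up to scaling, the sum is a finite sum plus a geometric series, so
it lies in every field which contains the initial pair. -/
theorem tsum_mem {K : IntermediateField ℚ ℝ} {p : ℝ × ℝ} (hp : Incommensurable p) (h1 : p.1 ∈ K)
    (h2 : p.2 ∈ K) (hsum : Summable fun k => (euclid^[k] p).1 + (euclid^[k] p).2) {i j : ℕ}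
    (hij : i < j)
    (hper : (euclid^[i] p).1 * (euclid^[j] p).2 = (euclid^[j] p).1 * (euclid^[i] p).2) :
    ∑' k, ((euclid^[k] p).1 + (euclid^[k] p).2) ∈ K := by
  set v := fun k => euclid^[k] p with hv
  set s := fun k => (v k).1 + (v k).2 with hs
  have hinc : ∀ k, Incommensurable (v k) := hp.iterate
  have hsK : ∀ k, s k ∈ K := fun k => add_mem (iterate_mem h1 h2 k).1 (iterate_mem h1 h2 k).2
  obtain ⟨d, rfl⟩ := Nat.exists_eq_add_of_lt hij
  set c := (v (i + d + 1)).1 / (v i).1 with hc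
  have hc0 : 0 < c := div_pos (hinc _).1 (hinc _).1
  have hcK : c ∈ K := div_mem (iterate_mem h1 h2 _).1 (iterate_mem h1 h2 _).1
  have hscale : v (i + d + 1) = c • v i := by
    have hne := (hinc i).1.ne'
    ext
    · simp [hc, hne]
    · simp only [Prod.smul_snd, smul_eq_mul, hc]
      rw [div_mul_eq_mul_div, eq_div_iff hne, mul_comm, hper]
  have hadd : ∀ m k, v (m + k) = euclid^[k] (v m) := fun m k => by
    simp only [hv]
    rw [add_comm, Function.iterate_add_apply]
  have hshift : ∀ k, s (k + (i + d + 1)) = c * s (k + i) := by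
    intro k
    simp only [hs]
    rw [add_comm k, hadd, hscale, iterate_euclid_smul hc0, add_comm k, hadd]
    simp [mul_add]
  have hstep : ∀ k, s (k + 1) < s k := by
    intro k
    have h1 : s (k + 1) = s k - min (v k).1 (v k).2 := by
      simp only [hs, hv, Function.iterate_succ_apply', sum_euclid]
    have h2 : 0 < min (v k).1 (v k).2 := lt_min (hinc k).1 (hinc k).2.1
    linarith
  have hc1 : c < 1 := by
    have h3 := hshift 0
    simp only [zero_add] at h3
    have h4 : s (i + d + 1) < s i := strictAnti_nat_of_succ_lt hstep (by omega)
    have h5 : 0 < s i := add_pos (hinc i).1 (hinc i).2.1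
    rw [h3] at h4
    nlinarith
  have e1 := hsum.sum_add_tsum_nat_add i
  have hsum' : Summable fun k => s (k + i) := (summable_nat_add_iff i).2 hsum
  have e2 := hsum'.sum_add_tsum_nat_add (d + 1)
  have e3 : ∑' k, s (k + (d + 1) + i) = c * ∑' k, s (k + i) := by
    rw [← tsum_mul_left]
    refine tsum_congr fun k => ?_
    rw [← hshift]
    congr 1
    omega
  rw [e3] at e2
  have hT : ∑' k, s (k + i) = (∑ k ∈ Finset.range (d + 1), s (k + i)) / (1 - c) := by
    rw [eq_div_iff (by linarith)]
    linarith
  change ∑' k, s k ∈ K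
  change ∑ k ∈ Finset.range i, s k + ∑' k, s (k + i) = ∑' k, s k at e1
  rw [← e1, hT]
  exact add_mem (sum_mem fun k _ => hsK k)
    (div_mem (sum_mem fun k _ => hsK _) (sub_mem (one_mem K) hcK))

/-! ### Good rational approximations -/

theorem le_of_euclid_le {p q : ℝ × ℝ} (h : p.1 < p.2 ↔ q.1 < q.2) (hle : euclid p ≤ euclid q) :
    p ≤ q := by
  simp only [euclid, ← h] at hle
  split_ifs at hle with hlt
  · obtain ⟨h1, h2⟩ := hle
    simp only at h1 h2
    exact ⟨h1, by linarith⟩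
  · obtain ⟨h1, h2⟩ := hle
    simp only at h1 h2
    exact ⟨by linarith, h2⟩

/-- Componentwise inequalities propagate backwards along common steps of the algorithm. -/
theorem iterate_le_of_le {p q : ℝ × ℝ} {j k : ℕ}
    (h : ∀ i < k, ((euclid^[i] p).1 < (euclid^[i] p).2 ↔ (euclid^[i] q).1 < (euclid^[i] q).2))
    (hjk : j ≤ k) (hle : euclid^[k] p ≤ euclid^[k] q) : euclid^[j] p ≤ euclid^[j] q := by
  induction k, hjk using Nat.le_induction with
  | base => exact hle
  | succ k _ ih =>
    refine ih (fun i hi => h i (by omega)) (le_of_euclid_le (h k (by omega)) ?_)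
    rwa [← Function.iterate_succ_apply' euclid, ← Function.iterate_succ_apply' euclid]

/-- The determinant of two pairs of real numbers. -/
def pairDet (p q : ℝ × ℝ) : ℝ := p.1 * q.2 - p.2 * q.1

theorem pairDet_euclid {p q : ℝ × ℝ} (h : p.1 < p.2 ↔ q.1 < q.2) :
    pairDet (euclid p) (euclid q) = pairDet p q := by
  simp only [euclid, ← h, pairDet]
  split_ifs <;> simp only <;> ring

theorem pairDet_iterate {p q : ℝ × ℝ} {k : ℕ}
    (h : ∀ i < k, ((euclid^[i] p).1 < (euclid^[i] p).2 ↔ (euclid^[i] q).1 < (euclid^[i] q).2)) :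
    pairDet (euclid^[k] p) (euclid^[k] q) = pairDet p q := by
  induction k with
  | zero => rfl
  | succ k ih =>
    rw [Function.iterate_succ_apply', Function.iterate_succ_apply', pairDet_euclid (h k (by omega)),
      ih fun i hi => h i (by omega)]

theorem branch_smul {c : ℝ} (hc : 0 < c) (p : ℝ × ℝ) (i : ℕ) :
    (euclid^[i] (c • p)).1 < (euclid^[i] (c • p)).2 ↔ (euclid^[i] p).1 < (euclid^[i] p).2 := by
  rw [iterate_euclid_smul hc]
  simp [hc]

/-- If `|ζ - a / b| < 1 / b²`, the algorithm takes the same steps for `(a, b)` as for `(ζ, 1)` until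
it reaches `(1, 1)`. Otherwise, at the first different step, the determinant of the two pairs times
the pair of integers exceeds the real pair in both components; this propagates back to the
beginning, where it contradicts the quality of the approximation. -/
theorem branch_iff {ζ : ℝ} (hζ : Incommensurable (ζ, 1)) {a b : ℤ} (hp : Admissible (a, b))
    (happ : |ζ * b - a| * b < 1) {k : ℕ} (hk : 0 < (layer (a, b) (k + 1)).1) :
    (euclid^[k] (castPair (a, b))).1 < (euclid^[k] (castPair (a, b))).2 ↔
      (euclid^[k] (ζ, (1 : ℝ))).1 < (euclid^[k] (ζ, (1 : ℝ))).2 := by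
  induction k using Nat.strong_induction_on with
  | _ k ih =>
  have hbr : ∀ i < k, ((euclid^[i] (castPair (a, b))).1 < (euclid^[i] (castPair (a, b))).2 ↔
      (euclid^[i] (ζ, (1 : ℝ))).1 < (euclid^[i] (ζ, (1 : ℝ))).2) :=
    fun i hi => ih i hi (layer_pos_of_le hp (by omega) hk)
  have hdet := pairDet_iterate hbr
  have hv := hζ.iterate k
  have hk0 := layer_pos_of_succ hp hk
  have hk2 := (layer_admissible hp k).nonneg.2
  have hne : (layer (a, b) k).1 ≠ (layer (a, b) k).2 := by
    intro h
    rw [layer_succ, euclid, h] at hk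
    simp at hk
  set v := euclid^[k] (ζ, (1 : ℝ)) with hvdef
  set w := layer (a, b) k with hwdef
  have hw : euclid^[k] (castPair (a, b)) = castPair w := (castPair_layer _ _).symm
  rw [hw] at hdet ⊢
  set δ := |ζ * b - a| with hδ
  have hδ' : |w.1 * v.2 - w.2 * v.1| = δ := by
    have : pairDet (castPair w) v = (w.1 : ℝ) * v.2 - w.2 * v.1 := rfl
    rw [← this, hdet, hδ, ← abs_neg]
    congr 1
    simp [pairDet, castPair]
    ring
  have hw1 : (1 : ℝ) ≤ w.1 := by exact_mod_cast hk0
  have hw2 : (1 : ℝ) ≤ w.2 := by exact_mod_cast hk2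
  -- It suffices to exclude that the determinant is at least as large as both components of `v`.
  have hcontra : ¬ (v.1 ≤ δ ∧ v.2 ≤ δ) := by
    rintro ⟨h1, h2⟩
    have hδ0 : 0 < δ := hv.1.trans_le h1
    have hle : euclid^[k] (ζ, (1 : ℝ)) ≤ euclid^[k] (δ • castPair (a, b)) := by
      rw [iterate_euclid_smul hδ0, hw]
      refine ⟨h1.trans ?_, h2.trans ?_⟩ <;>
        simp only [castPair, Prod.smul_fst, Prod.smul_snd, smul_eq_mul] <;>
        exact le_mul_of_one_le_right hδ0.le (by assumption)
    have := (iterate_le_of_le (fun i hi => ((branch_smul hδ0 _ i).trans (hbr i hi)).symm)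
      (Nat.zero_le k) hle).2
    simp only [Function.iterate_zero, id, castPair, Prod.smul_snd, smul_eq_mul] at this
    linarith
  change (w.1 : ℝ) < w.2 ↔ v.1 < v.2
  rcases lt_or_gt_of_ne hne with hlt | hlt
  · refine iff_of_true (by exact_mod_cast hlt) ?_
    by_contra! hge
    refine hcontra ?_
    have hlt' : (w.1 : ℝ) + 1 ≤ w.2 := by exact_mod_cast hlt
    have : v.1 ≤ δ := by
      rw [← hδ', abs_sub_comm]
      refine le_trans ?_ (le_abs_self _)
      nlinarith [hv.1]
    exact ⟨this, hge.trans this⟩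
  · refine iff_of_false (by exact_mod_cast hlt.not_gt) ?_
    intro hlt2
    refine hcontra ?_
    have hlt' : (w.2 : ℝ) + 1 ≤ w.1 := by exact_mod_cast hlt
    have : v.2 ≤ δ := by
      rw [← hδ']
      refine le_trans ?_ (le_abs_self _)
      nlinarith [hv.2.1]
    exact ⟨hlt2.le.trans this, this⟩

theorem layer_eq_one {p : ℤ × ℤ} (hp : Admissible p) {m : ℕ} (h : 0 < (layer p m).1)
    (h' : ¬ 0 < (layer p (m + 1)).1) : layer p m = (1, 1) := by
  rcases layer_admissible hp m with ⟨h1, h2, h3⟩ | h0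
  · rw [layer_succ, euclid] at h'
    split_ifs at h' with hlt
    · exact absurd h1 h'
    · have heq : (layer p m).1 = (layer p m).2 := by
        simp only [not_lt] at h' hlt
        omega
      rw [heq] at h3 h1
      have := eq_one_of_isCoprime_self h1 h3
      exact Prod.ext (heq.trans this) this
  · rw [h0] at h
    exact absurd h (by simp)

/-- The contributions of the layers for `(a, b)` are dominated by those for `(ζ, 1)`. -/
theorem weight_le {ζ : ℝ} (hζ : Incommensurable (ζ, 1)) {κ : ℝ} (hκ : 0 < κ)
    (hbdd : ∀ k, κ * max (euclid^[k] (ζ, (1 : ℝ))).1 (euclid^[k] (ζ, (1 : ℝ))).2 ≤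
      min (euclid^[k] (ζ, (1 : ℝ))).1 (euclid^[k] (ζ, (1 : ℝ))).2)
    {a b : ℤ} (hp : Admissible (a, b)) (happ : |ζ * b - a| * b < 1) (j : ℕ) :
    weight (euclid^[j] ((a : ℝ) / b, (1 : ℝ))) ≤
      κ⁻¹ * ((euclid^[j] (ζ, (1 : ℝ))).1 + (euclid^[j] (ζ, (1 : ℝ))).2) := by
  have hb : 0 < b := hp.nonneg.2
  have hb' : (0 : ℝ) < b := by exact_mod_cast hb
  have hj := hζ.iterate j
  have hsum : 0 < (euclid^[j] (ζ, (1 : ℝ))).1 + (euclid^[j] (ζ, (1 : ℝ))).2 :=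
    add_pos hj.1 hj.2.1
  by_cases hlive : 0 < (layer (a, b) j).1
  swap
  · have h0 := weight_layer (a := a) hb j
    rw [weight, if_neg hlive, Int.cast_zero, eq_comm, mul_eq_zero] at h0
    rw [h0.resolve_left hb'.ne']
    positivity
  -- Let `m` be the index of the innermost layer.
  obtain ⟨m, hjm, hm, hm'⟩ : ∃ m, j ≤ m ∧ 0 < (layer (a, b) m).1 ∧
      ¬ 0 < (layer (a, b) (m + 1)).1 := by
    by_contra! H
    have : ∀ m, j ≤ m → 0 < (layer (a, b) m).1 := by
      intro m hm
      induction m, hm using Nat.le_induction with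
      | base => exact hlive
      | succ m hm ih => exact H m hm ih
    have h1 := layer_lt hp (this (max j ((a, b).1 + (a, b).2).toNat) (le_max_left _ _))
    omega
  have hone := layer_eq_one hp hm hm'
  have hbr : ∀ i < m, ((euclid^[i] (castPair (a, b))).1 < (euclid^[i] (castPair (a, b))).2 ↔
      (euclid^[i] (ζ, (1 : ℝ))).1 < (euclid^[i] (ζ, (1 : ℝ))).2) :=
    fun i hi => branch_iff hζ hp happ (layer_pos_of_le hp (by omega) hm)
  have hw : euclid^[m] (castPair (a, b)) = (1, 1) := by
    rw [← castPair_layer, hone]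
    simp [castPair]
  have hvm := hζ.iterate m
  have hmin := hbdd m
  set v := euclid^[m] (ζ, (1 : ℝ)) with hv
  set M := max v.1 v.2 with hM
  have hMpos : 0 < M := lt_max_of_lt_left hvm.1
  have hκM : 0 < (κ * M)⁻¹ := inv_pos.2 (mul_pos hκ hMpos)
  -- The pair `(1, 1)` lies between `M⁻¹ v` and `(κ M)⁻¹ v`.
  have hupper : euclid^[j] (castPair (a, b)) ≤ euclid^[j] ((κ * M)⁻¹ • (ζ, (1 : ℝ))) := by
    refine iterate_le_of_le (fun i hi => (hbr i hi).trans (branch_smul hκM _ i).symm) hjm ?_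
    rw [iterate_euclid_smul hκM, hw, ← hv]
    have h1 : κ * M ≤ v.1 := hmin.trans (min_le_left _ _)
    have h2 : κ * M ≤ v.2 := hmin.trans (min_le_right _ _)
    constructor <;> simp only [Prod.smul_fst, Prod.smul_snd, smul_eq_mul]
    · rw [inv_mul_eq_div, one_le_div (mul_pos hκ hMpos)]; exact h1
    · rw [inv_mul_eq_div, one_le_div (mul_pos hκ hMpos)]; exact h2
  have hlower : euclid^[0] (ζ, (1 : ℝ)) ≤ euclid^[0] (M • castPair (a, b)) := by
    refine iterate_le_of_le (fun i hi => ((branch_smul hMpos _ i).trans (hbr i hi)).symm)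
      (Nat.zero_le m) ?_
    rw [iterate_euclid_smul hMpos, hw, ← hv]
    constructor <;> simp only [Prod.smul_fst, Prod.smul_snd, smul_eq_mul, mul_one]
    · exact le_max_left _ _
    · exact le_max_right _ _
  have hMb : 1 ≤ M * b := hlower.2
  rw [iterate_euclid_smul hκM] at hupper
  have h1 := hupper.1
  have h2 := hupper.2
  have hcast := castPair_layer (a, b) j
  rw [← hcast, iterate_euclid_div hb] at h1 h2
  simp only [Prod.smul_fst, Prod.smul_snd, smul_eq_mul] at h1 h2
  set u := euclid^[j] ((a : ℝ) / b, (1 : ℝ)) with hu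
  set t := (euclid^[j] (ζ, (1 : ℝ))).1 + (euclid^[j] (ζ, (1 : ℝ))).2 with ht
  have h3 : (b : ℝ) * (u.1 + u.2) ≤ (κ * M)⁻¹ * t := by
    rw [ht]
    linarith
  have h4 : (κ * M)⁻¹ * t ≤ b * (κ⁻¹ * t) := by
    rw [mul_inv, mul_comm κ⁻¹, mul_assoc]
    refine mul_le_mul_of_nonneg_right ?_ (by positivity)
    rw [inv_le_iff_one_le_mul₀' hMpos]
    exact hMb
  have h5 : u.1 + u.2 ≤ κ⁻¹ * t := le_of_mul_le_mul_left (h3.trans h4) hb'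
  rw [weight]
  split_ifs
  · exact h5
  · positivity

theorem tsum_weight {a b : ℤ} (hp : Admissible (a, b)) :
    (b : ℝ) * ∑' k, weight (euclid^[k] ((a : ℝ) / b, (1 : ℝ))) =
      ((∑ k ∈ Finset.range (a + b).toNat, weight (layer (a, b) k) : ℤ) : ℝ) := by
  have hb : 0 < b := hp.nonneg.2
  have hb' : (0 : ℝ) < b := by exact_mod_cast hb
  rw [tsum_eq_sum (s := Finset.range (a + b).toNat), Finset.mul_sum, Int.cast_sum]
  · exact Finset.sum_congr rfl fun k _ => (weight_layer hb k).symm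
  · intro k hk
    rw [Finset.mem_range] at hk
    have h0 : weight (layer (a, b) k) = 0 := if_neg fun h => hk (layer_lt hp h)
    have := weight_layer (a := a) hb k
    rw [h0, Int.cast_zero, eq_comm, mul_eq_zero] at this
    exact this.resolve_left hb'.ne'

/-- For good rational approximations of `ζ`, the sum over the layers converges to the corresponding
sum at `ζ`, by dominated convergence. -/
theorem tendsto_tsum_weight {ζ : ℝ} (hζ : Incommensurable (ζ, 1)) {κ : ℝ} (hκ : 0 < κ)
    (hbdd : ∀ k, κ * max (euclid^[k] (ζ, (1 : ℝ))).1 (euclid^[k] (ζ, (1 : ℝ))).2 ≤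
      min (euclid^[k] (ζ, (1 : ℝ))).1 (euclid^[k] (ζ, (1 : ℝ))).2)
    {a b : ℕ → ℤ} (hp : ∀ n, Admissible (a n, b n)) (happ : ∀ n, |ζ * b n - a n| * b n < 1)
    (hlim : Filter.Tendsto (fun n => (a n : ℝ) / b n) Filter.atTop (nhds ζ)) :
    Filter.Tendsto (fun n => ∑' k, weight (euclid^[k] ((a n : ℝ) / b n, (1 : ℝ)))) Filter.atTop
      (nhds (∑' k, ((euclid^[k] (ζ, (1 : ℝ))).1 + (euclid^[k] (ζ, (1 : ℝ))).2))) := by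
  refine tendsto_tsum_of_dominated_convergence ((summable_sum hζ hκ hbdd).mul_left κ⁻¹)
    (fun k => ?_) (Filter.Eventually.of_forall fun n k => ?_)
  · have h1 : Filter.Tendsto (fun n => ((a n : ℝ) / b n, (1 : ℝ))) Filter.atTop
        (nhds (ζ, (1 : ℝ))) := hlim.prodMk_nhds tendsto_const_nhds
    have h2 := (hζ.continuousAt_iterate k).tendsto.comp h1
    have h3 := (continuousAt_weight (hζ.iterate k).1).tendsto.comp h2
    rwa [weight, if_pos (hζ.iterate k).1] at h3
  · rw [Real.norm_of_nonneg]
    · exact weight_le hζ hκ hbdd (hp n) (happ n) k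
    · have hb : (0 : ℝ) < b n := by exact_mod_cast (hp n).nonneg.2
      have h := weight_layer (a := a n) (hp n).nonneg.2 k
      have h0 : (0 : ℤ) ≤ weight (layer (a n, b n) k) := by
        rw [weight]
        split_ifs with hpos
        · have := (layer_admissible (hp n) k).nonneg.2
          omega
        · exact le_rfl
      have h0' : (0 : ℝ) ≤ b n * weight (euclid^[k] ((a n : ℝ) / b n, (1 : ℝ))) := by
        rw [← h]
        exact_mod_cast h0
      exact nonneg_of_mul_nonneg_right h0' hb

/-! ### Convergents -/

/-- The numerators and denominators of the convergents are integers. -/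
theorem exists_int_eq_contsAux (ζ : ℝ) (hζ : Irrational ζ) (n : ℕ) :
    (∃ p q : ℤ, (GenContFract.of ζ).contsAux n = ⟨p, q⟩) ∧
      ∃ p q : ℤ, (GenContFract.of ζ).contsAux (n + 1) = ⟨p, q⟩ := by
  induction n with
  | zero =>
    refine ⟨⟨1, 0, ?_⟩, ⟨⌊ζ⌋, 1, ?_⟩⟩
    · simp [GenContFract.zeroth_contAux_eq_one_zero]
    · simp [GenContFract.first_contAux_eq_h_one, GenContFract.of_h_eq_floor]
  | succ n ih =>
    obtain ⟨⟨p, q, h⟩, p', q', h'⟩ := ih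
    refine ⟨⟨p', q', h'⟩, ?_⟩
    have hterm : ¬ (GenContFract.of ζ).TerminatedAt n := by
      intro ht
      obtain ⟨r, hr⟩ := (GenContFract.terminates_iff_rat ζ).1 ⟨n, ht⟩
      exact hζ ⟨r, hr.symm⟩
    obtain ⟨gp, hgp⟩ := Option.ne_none_iff_exists'.1 hterm
    obtain ⟨ha, z, hz⟩ := GenContFract.of_partNum_eq_one_and_exists_int_partDen_eq hgp
    refine ⟨z * p' + p, z * q' + q, ?_⟩
    rw [GenContFract.contsAux_recurrence hgp h h', ha, hz]
    simp

/-- A convergent `a / b` in lowest terms satisfies `|ζ - a / b| < 1 / b²`. -/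
theorem convergent_approx {ζ : ℝ} (hζ : Irrational ζ) (hpos : 0 < ζ) {a b : ℕ} (hb : 0 < b)
    (hcop : Nat.Coprime a b) {n : ℕ} (h : (a : ℝ) / b = (GenContFract.of ζ).convs n) :
    |ζ * b - a| * b < 1 := by
  have hb' : (0 : ℝ) < b := by exact_mod_cast hb
  have hterm : ∀ n, ¬ (GenContFract.of ζ).TerminatedAt n := by
    intro n ht
    obtain ⟨r, hr⟩ := (GenContFract.terminates_iff_rat ζ).1 ⟨n, ht⟩
    exact hζ ⟨r, hr.symm⟩
  obtain ⟨p, q, hpq⟩ := (exists_int_eq_contsAux ζ hζ n).2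
  have hden : (GenContFract.of ζ).dens n = q := by
    rw [GenContFract.den_eq_conts_b, GenContFract.nth_cont_eq_succ_nth_contAux, hpq]
  have hnum : (GenContFract.of ζ).nums n = p := by
    rw [GenContFract.num_eq_conts_a, GenContFract.nth_cont_eq_succ_nth_contAux, hpq]
  have hq : (1 : ℝ) ≤ q := by
    rw [← hden]
    refine le_trans ?_ (GenContFract.succ_nth_fib_le_of_nth_den (Or.inr (hterm _)))
    exact_mod_cast Nat.fib_pos.2 n.succ_pos
  have hq0 : (0 : ℝ) < q := by linarith
  rw [GenContFract.conv_eq_num_div_den, hden, hnum, div_eq_div_iff hb'.ne' hq0.ne'] at h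
  have hint : (a : ℤ) * q = p * b := by exact_mod_cast h
  have hdvd : (b : ℤ) ∣ q := by
    have h1 : (b : ℤ) ∣ a * q := ⟨p, by rw [hint]; ring⟩
    exact (Int.isCoprime_iff_gcd_eq_one.2 (by simpa using hcop.symm)).dvd_of_dvd_mul_left h1
  have hbq : (b : ℝ) ≤ q := by
    have := Int.le_of_dvd (by exact_mod_cast hq0) hdvd
    exact_mod_cast this
  have hle := GenContFract.abs_sub_convs_le (hterm n)
  have hmono : (q : ℝ) ≤ (GenContFract.of ζ).dens (n + 1) := hden ▸ GenContFract.of_den_mono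
  rw [GenContFract.conv_eq_num_div_den, hden, hnum, ← (div_eq_div_iff hb'.ne' hq0.ne').2 h] at hle
  have h1 : |ζ - a / b| ≤ 1 / (b * b) :=
    hle.trans (one_div_le_one_div_of_le (mul_pos hb' hb')
      (mul_le_mul hbq (hbq.trans hmono) hb'.le hq0.le))
  have h2 : |ζ * b - a| = |ζ - a / b| * b := by
    rw [← abs_of_pos hb', ← abs_mul, abs_of_pos hb', sub_mul, div_mul_cancel₀ _ hb'.ne']
  have h3 : |ζ * b - a| * b ≤ 1 := by
    rw [h2, mul_assoc]
    rwa [le_div_iff₀ (mul_pos hb' hb')] at h1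
  -- Equality is impossible, since `ζ` is irrational.
  refine lt_of_le_of_ne h3 fun heq => ?_
  have hinc := (incommensurable_of_irrational hζ hpos).2.2
  have hbb : ((b : ℤ) * b) ≠ 0 := by positivity
  rcases abs_choice (ζ * b - a) with hc | hc
  · exact hbb (hinc (b * b) (-(a * b) - 1) (by
      push_cast; rw [hc] at heq; simp only [mul_one]; linarith)).1
  · exact hbb (hinc (b * b) (-(a * b) + 1) (by
      push_cast; rw [hc] at heq; simp only [mul_one]; linarith)).1

/-- A quadratic irrational is a root of an integral quadratic polynomial. -/
theorem exists_quadratic {ζ : ℝ} (h : (minpoly ℚ ζ).natDegree = 2) :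
    Irrational ζ ∧ ∃ A B C : ℤ, 0 < A ∧ (A : ℝ) * ζ ^ 2 + B * ζ + C = 0 := by
  have hint : IsIntegral ℚ ζ := by
    by_contra hn
    rw [minpoly.eq_zero hn] at h
    simp at h
  constructor
  · rintro ⟨r, hr⟩
    have := (minpoly.natDegree_eq_one_iff (A := ℚ) (x := ζ)).2 ⟨r, hr⟩
    omega
  · have hroot := minpoly.aeval ℚ ζ
    have hlead : (minpoly ℚ ζ).coeff 2 = 1 := by
      have := (minpoly.monic hint).coeff_natDegree
      rwa [h] at this
    rw [Polynomial.aeval_eq_sum_range, h] at hroot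
    simp only [Finset.sum_range_succ, Finset.sum_range_zero, hlead] at hroot
    set r := (minpoly ℚ ζ).coeff 1
    set s := (minpoly ℚ ζ).coeff 0
    simp only [Rat.smul_def, Rat.cast_one, pow_zero, pow_one, one_mul, mul_one, zero_add] at hroot
    refine ⟨r.den * s.den, r.num * s.den, s.num * r.den, by positivity, ?_⟩
    have hr : (r : ℝ) * r.den = r.num := by
      exact_mod_cast congrArg (Rat.cast (K := ℝ)) (Rat.mul_den_eq_num r)
    have hs : (s : ℝ) * s.den = s.num := by
      exact_mod_cast congrArg (Rat.cast (K := ℝ)) (Rat.mul_den_eq_num s)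
    push_cast
    rw [← hr, ← hs]
    linear_combination (r.den : ℝ) * s.den * hroot

/-- Fractions which converge to an irrational number have denominators tending to infinity. -/
theorem tendsto_den_atTop {a b : ℕ → ℕ} {ζ : ℝ} (hζ : Irrational ζ)
    (hlim : Filter.Tendsto (fun n => (a n : ℝ) / (b n : ℝ)) Filter.atTop (nhds ζ)) :
    Filter.Tendsto (fun n => (b n : ℝ)) Filter.atTop Filter.atTop := by
  refine tendsto_natCast_atTop_atTop.comp (Filter.tendsto_atTop.2 fun N => ?_)
  have h0 : ∀ᶠ ε in nhdsWithin (0 : ℝ) (Set.Ioi 0), 0 < ε ∧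
      ∀ k ≤ N, ∀ m : ℤ, ε ≤ dist ζ (m / k) :=
    (eventually_mem_nhdsWithin).and
      ((hζ.eventually_forall_le_dist_cast_div_of_denom_le N).filter_mono nhdsWithin_le_nhds)
  obtain ⟨ε, hε, h⟩ := h0.exists
  filter_upwards [Metric.tendsto_nhds.1 hlim ε hε] with n hn
  by_contra! hlt
  have := h (b n) hlt.le (a n)
  rw [dist_comm] at this
  simp only [Int.cast_natCast] at this
  linarith

/-! ### The limits -/

theorem admissible_of_coprime {a b : ℕ} (ha : 0 < a) (hb : 0 < b) (h : Nat.Coprime a b) :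
    Admissible ((a : ℤ), (b : ℤ)) :=
  .inl ⟨Int.natCast_pos.2 ha, Int.natCast_pos.2 hb, Nat.isCoprime_iff_coprime.2 h⟩

/-- The fold count in terms of the normalized sum over the layers. -/
theorem foldCount_bounds_tsum {a b : ℕ} (ha : 0 < a) (hb : 0 < b) (h : Nat.Coprime a b) :
    2 * (b * ∑' k, weight (euclid^[k] ((a : ℝ) / b, (1 : ℝ)))) ≤ foldCount ⟨(a : ℤ), (b : ℤ)⟩ ∧
    (foldCount ⟨(a : ℤ), (b : ℤ)⟩ : ℝ) ≤
      2 * (b * ∑' k, weight (euclid^[k] ((a : ℝ) / b, (1 : ℝ)))) + 4 := by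
  have hp := admissible_of_coprime ha hb h
  have h1 := tsum_weight hp
  obtain ⟨h2, h3⟩ := foldCount_bounds (β := ⟨(a : ℤ), (b : ℤ)⟩) hp
    (Int.natCast_pos.2 ha)
  simp only [Int.cast_natCast] at h1
  rw [h1]
  exact ⟨by exact_mod_cast h2, by exact_mod_cast h3⟩

theorem faceCount_eq_real {a b : ℕ} (ha : 0 < a) (hb : 0 < b) :
    (faceCount ⟨(a : ℤ), (b : ℤ)⟩ : ℝ) = 2 * ((a : ℝ) ^ 2 + a * b + b ^ 2) := by
  have := faceCount_eq (β := ⟨(a : ℤ), (b : ℤ)⟩) (Int.natCast_pos.2 ha) (Int.natCast_pos.2 hb)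
  simp only at this
  exact_mod_cast this

/-- For every `m`, the ratio of the fold count and the number of faces is, up to an error which
vanishes as `b → ∞`, at most the squared size of the pair reached after `m` steps. -/
theorem foldCount_div_faceCount_le {a b : ℕ} (ha : 0 < a) (hab : a < b) (h : Nat.Coprime a b)
    (m : ℕ) : (foldCount ⟨(a : ℤ), (b : ℤ)⟩ : ℝ) / faceCount ⟨(a : ℤ), (b : ℤ)⟩ ≤
      (2 * m + 2) / b + ((euclid^[m] ((a : ℝ) / b, (1 : ℝ))).1 +
        (euclid^[m] ((a : ℝ) / b, (1 : ℝ))).2) ^ 2 := by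
  have hb := ha.trans hab
  have ha' : (0 : ℝ) < a := by exact_mod_cast ha
  have hb' : (1 : ℝ) ≤ b := by exact_mod_cast hb
  have hab' : (a : ℝ) ≤ b := by exact_mod_cast hab.le
  have hp := admissible_of_coprime ha hb h
  have h1 := (foldCount_bounds (β := ⟨(a : ℤ), (b : ℤ)⟩) hp
    (Int.natCast_pos.2 ha)).2
  have h2 := sum_weight_le hp ((a : ℤ) + b).toNat m
  have h3 : (foldCount ⟨(a : ℤ), (b : ℤ)⟩ : ℤ) ≤ 2 * (m * ((a : ℤ) + b) +
      ((layer ((a : ℤ), (b : ℤ)) m).1 + (layer ((a : ℤ), (b : ℤ)) m).2) ^ 2) + 4 :=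
    h1.trans (by simp only at h2 ⊢; linarith)
  have h4 : (foldCount ⟨(a : ℤ), (b : ℤ)⟩ : ℝ) ≤ 2 * (m * ((a : ℝ) + b) +
      (((layer ((a : ℤ), (b : ℤ)) m).1 : ℝ) + (layer ((a : ℤ), (b : ℤ)) m).2) ^ 2) + 4 := by
    exact_mod_cast h3
  have h5 := iterate_euclid_div (a := a) (b := b) (by exact_mod_cast hb) m
  simp only [Int.cast_natCast] at h5
  have e1 : ((layer ((a : ℤ), (b : ℤ)) m).1 : ℝ) = b * (euclid^[m] ((a : ℝ) / b, (1 : ℝ))).1 :=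
    congrArg Prod.fst h5
  have e2 : ((layer ((a : ℤ), (b : ℤ)) m).2 : ℝ) = b * (euclid^[m] ((a : ℝ) / b, (1 : ℝ))).2 :=
    congrArg Prod.snd h5
  rw [e1, e2, ← mul_add] at h4
  set t := (euclid^[m] ((a : ℝ) / b, (1 : ℝ))).1 + (euclid^[m] ((a : ℝ) / b, (1 : ℝ))).2
  rw [faceCount_eq_real ha hb]
  have h6 : (foldCount ⟨(a : ℤ), (b : ℤ)⟩ : ℝ) ≤ 2 * b ^ 2 * ((2 * m + 2) / b + t ^ 2) := by
    have e3 : 2 * (b : ℝ) ^ 2 * ((2 * m + 2) / b + t ^ 2) =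
        2 * (m * (b + b) + (b * t) ^ 2) + 4 * b := by
      field_simp
      ring
    rw [e3]
    have : (m : ℝ) * (a + b) ≤ m * (b + b) :=
      mul_le_mul_of_nonneg_left (by linarith) (Nat.cast_nonneg m)
    linarith
  rw [div_le_iff₀ (by positivity)]
  refine h6.trans ?_
  rw [mul_comm]
  refine mul_le_mul_of_nonneg_left ?_ (by positivity)
  nlinarith [mul_pos ha' (by linarith : (0 : ℝ) < b)]

theorem tendsto_foldCount_div_faceCount {a b : ℕ → ℕ} (ha : ∀ n, 0 < a n)
    (hab : ∀ n, a n < b n) (hcop : ∀ n, Nat.Coprime (a n) (b n)) {ζ : ℝ} (hζ : Irrational ζ)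
    (hlim : Filter.Tendsto (fun n => (a n : ℝ) / (b n : ℝ)) Filter.atTop (nhds ζ)) :
    Filter.Tendsto (fun n => (foldCount ⟨(a n : ℤ), (b n : ℤ)⟩ : ℝ) /
      (faceCount ⟨(a n : ℤ), (b n : ℤ)⟩ : ℝ)) Filter.atTop (nhds 0) := by
  have hζ0 : 0 < ζ := lt_of_le_of_ne
    (ge_of_tendsto' hlim fun n => by positivity) fun h => hζ ⟨0, by simpa using h⟩
  have hinc := incommensurable_of_irrational hζ hζ0
  have hden := tendsto_den_atTop hζ hlim
  have hpair : Filter.Tendsto (fun n => ((a n : ℝ) / b n, (1 : ℝ))) Filter.atTop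
      (nhds (ζ, (1 : ℝ))) := hlim.prodMk_nhds tendsto_const_nhds
  rw [Metric.tendsto_atTop']
  intro ε hε
  -- Choose `m` such that the pair reached after `m` steps from `(ζ, 1)` is small.
  have hsmall := hinc.tendsto_sum.pow 2
  rw [zero_pow two_ne_zero] at hsmall
  obtain ⟨m, hm⟩ := (hsmall.eventually (gt_mem_nhds (half_pos hε))).exists
  have h1 := (hinc.continuousAt_iterate m).tendsto.comp hpair
  have h2 := ((continuous_fst.tendsto _).comp h1).add ((continuous_snd.tendsto _).comp h1)
  have h3 := (h2.pow 2).eventually (gt_mem_nhds hm)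
  have h4 : Filter.Tendsto (fun n => (2 * (m : ℝ) + 2) / b n) Filter.atTop (nhds 0) :=
    hden.const_div_atTop _
  obtain ⟨N, hN⟩ := Filter.eventually_atTop.1
    (h3.and (h4.eventually (gt_mem_nhds (half_pos hε))))
  refine ⟨N, fun n hn => ?_⟩
  obtain ⟨h5, h6⟩ := hN n hn.le
  rw [Real.dist_0_eq_abs, abs_of_nonneg (by positivity)]
  refine (foldCount_div_faceCount_le (ha n) (hab n) (hcop n) m).trans_lt ?_
  simp only [Function.comp] at h5
  linarith

/-- The limit is `(2 S)² / (2 (ζ² + ζ + 1))`, where `S` is the sum of `x + y` over all pairs `(x, y)`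
which the subtractive Euclidean algorithm produces from `(ζ, 1)`. -/
theorem exists_tendsto_foldCount_sq_div_faceCount {a b : ℕ → ℕ} (ha : ∀ n, 0 < a n)
    (hab : ∀ n, a n < b n) (hcop : ∀ n, Nat.Coprime (a n) (b n)) {ζ : ℝ} (hζ0 : 0 < ζ)
    (hdeg : (minpoly ℚ ζ).natDegree = 2) (k : ℕ)
    (hconv : ∀ n, (a n : ℝ) / (b n : ℝ) = (GenContFract.of ζ).convs (n + k)) :
    ∃ L ∈ IntermediateField.adjoin ℚ {ζ},
      Filter.Tendsto (fun n => (foldCount ⟨(a n : ℤ), (b n : ℤ)⟩ : ℝ) ^ 2 /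
        (faceCount ⟨(a n : ℤ), (b n : ℤ)⟩ : ℝ)) Filter.atTop (nhds L) := by
  have hb : ∀ n, 0 < b n := fun n => (ha n).trans (hab n)
  have hb' : ∀ n, (0 : ℝ) < b n := fun n => by exact_mod_cast hb n
  obtain ⟨hζ, A, B, C, hA, hABC⟩ := exists_quadratic hdeg
  have hinc := incommensurable_of_irrational hζ hζ0
  obtain ⟨⟨κ, hκ, hbdd⟩, i, j, hij, hper⟩ := exists_period hζ hζ0 hA hABC
  set S := ∑' k, ((euclid^[k] (ζ, (1 : ℝ))).1 + (euclid^[k] (ζ, (1 : ℝ))).2) with hS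
  set K := IntermediateField.adjoin ℚ {ζ} with hK
  have hζK : ζ ∈ K := IntermediateField.mem_adjoin_simple_self ℚ ζ
  have hSK : S ∈ K :=
    tsum_mem hinc hζK (one_mem K) (summable_sum hinc hκ hbdd) hij hper
  have hlim : Filter.Tendsto (fun n => (a n : ℝ) / (b n : ℝ)) Filter.atTop (nhds ζ) := by
    simp only [hconv]
    exact (GenContFract.of_convergence ζ).comp (Filter.tendsto_add_atTop_nat k)
  have hden := tendsto_den_atTop hζ hlim
  have hsum : Filter.Tendsto
      (fun n => ∑' k, weight (euclid^[k] ((a n : ℝ) / b n, (1 : ℝ)))) Filter.atTop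
      (nhds S) := by
    have := tendsto_tsum_weight hinc hκ hbdd (a := fun n => (a n : ℤ)) (b := fun n => (b n : ℤ))
      (fun n => admissible_of_coprime (ha n) (hb n) (hcop n))
      (fun n => by
        simpa using convergent_approx hζ hζ0 (hb n) (hcop n) (hconv n))
      (by simpa using hlim)
    simpa using this
  have hfold : Filter.Tendsto
      (fun n => (foldCount ⟨(a n : ℤ), (b n : ℤ)⟩ : ℝ) / b n) Filter.atTop (nhds (2 * S)) := by
    have hup := (hsum.const_mul 2).add (hden.const_div_atTop 4)
    rw [add_zero] at hup
    refine tendsto_of_tendsto_of_tendsto_of_le_of_le (hsum.const_mul 2) hup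
      (fun n => ?_) (fun n => ?_)
    · simp only
      rw [le_div_iff₀ (hb' n)]
      linarith [(foldCount_bounds_tsum (ha n) (hb n) (hcop n)).1]
    · simp only
      rw [div_le_iff₀ (hb' n), add_mul, div_mul_cancel₀ _ (hb' n).ne']
      linarith [(foldCount_bounds_tsum (ha n) (hb n) (hcop n)).2]
  have hpos : 0 < 2 * (ζ ^ 2 + ζ + 1) := by positivity
  refine ⟨(2 * S) ^ 2 / (2 * (ζ ^ 2 + ζ + 1)), ?_, ?_⟩
  · have h2 : (2 : ℝ) ∈ K := ofNat_mem K 2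
    exact div_mem (pow_mem (mul_mem h2 hSK) 2)
      (mul_mem h2 (add_mem (add_mem (pow_mem hζK 2) hζK) (one_mem K)))
  · have hface := (((hlim.pow 2).add hlim).add_const 1).const_mul 2
    refine ((hfold.pow 2).div hface hpos.ne').congr fun n => ?_
    simp only [Pi.div_apply]
    rw [faceCount_eq_real (ha n) (hb n)]
    have := (hb' n).ne'
    have h1 : (0 : ℝ) < a n := by exact_mod_cast ha n
    have h2 := hb' n
    field_simp

end Eisenstein

theorem theorem1p1 (a b : ℕ → ℕ)
    (ha : ∀ n, 0 < a n) (hab : ∀ n, a n < b n) (hcop : ∀ n, Nat.Coprime (a n) (b n))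
    (f F : ℕ → ℕ)
    (hf : ∀ n, f n = Eisenstein.foldCount ⟨(a n : ℤ), (b n : ℤ)⟩)
    (hF : ∀ n, F n = Eisenstein.faceCount ⟨(a n : ℤ), (b n : ℤ)⟩) :
    (∀ ζ : ℝ, Irrational ζ →
      Filter.Tendsto (fun n => (a n : ℝ) / (b n : ℝ)) Filter.atTop (nhds ζ) →
      Filter.Tendsto (fun n => (f n : ℝ) / (F n : ℝ)) Filter.atTop (nhds 0)) ∧
    (∀ ζ : ℝ, 0 < ζ → ζ < 1 → (minpoly ℚ ζ).natDegree = 2 →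
      ∀ k : ℕ, (∀ n, (a n : ℝ) / (b n : ℝ) = (GenContFract.of ζ).convs (n + k)) →
      ∃ L ∈ IntermediateField.adjoin ℚ {ζ},
        Filter.Tendsto (fun n => (f n : ℝ) ^ 2 / (F n : ℝ)) Filter.atTop (nhds L)) := by
  simp only [hf, hF]
  exact ⟨fun ζ hζ hlim => Eisenstein.tendsto_foldCount_div_faceCount ha hab hcop hζ hlim,
    fun ζ hζ0 _ hdeg k hconv =>
      Eisenstein.exists_tendsto_foldCount_sq_div_faceCount ha hab hcop hζ0 hdeg k hconv⟩
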